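/- Let $\mathsf C$ be a site. A group-like stack on $\mathsf C$ is a stack in groupoids with a monoidal structure (compatible with restriction) such that left and right multiplication by every object are equivalences; it is braided if it carries a braiding compatible with restriction. Let $\mathcal G$ be a braided group-like stack. For group-like stacks $\mathcal H_1,\dots,\mathcal H_n$, a multi-additive ($n$-additive) functor $F\colon\mathcal H_1\times\dots\times\mathcal H_n\to\mathcal G$ is a morphism of stacks together with, for each $i$, isomorphisms $$\lambda^i\colon F(\dots,a,\dots)\,F(\dots,a',\dots)\to F(\dots,aa',\dots)$$ in the $i$-th variable, functorial in all variables and compatible with restriction, which make $F$ a monoidal functor of the $i$-th variable, and such that for every pair of variables $i<j$: (a) (interchange) writing $F(a,b)$ for the value of $F$ with $a$, $b$ in positions $i$, $j$ and the other variables fixed, the two morphisms $$\bigl(F(a,b)F(a',b)\bigr)\bigl(F(a,b')F(a',b')\bigr)\longrightarrow F(aa',bb')$$ given by $\lambda^j_{aa';b,b'}\circ(\lambda^i_{a,a';b}\,\lambda^i_{a,a';b'})$ and by $\lambda^i_{a,a';bb'}\circ(\lambda^j_{a;b,b'}\,\lambda^j_{a';b,b'})\circ\hat c$ are equal, where $\hat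 c\colon (xy)(zw)\to(xz)(yw)$ is induced by the braiding of $\mathcal G$; (b) the two isomorphisms $F(I,I)\cong I$ (with $I$ the unit in positions $i$ and $j$) determined by $\lambda^i$ and $\lambda^j$ coincide. If the $\mathcal H_i$ are braided, $F$ is called braided if for each $i$ the isomorphisms $\lambda^i$ carry the braiding of $\mathcal G$ to $F$ applied to the braiding of $\mathcal H_i$. Let $\mathcal G$ and $\mathcal H_1,\dots,\mathcal H_n$ be braided group-like stacks and $\mathcal K_{i,1},\dots,\mathcal K_{i,m_i}$ ($1\le i\le n$) group-like stacks. Let $F\colon\mathcal H_1\times\dots\times\mathcal H_n\to\mathcal G$ be a braided multi-additive functor and $G_i\colon\mathcal K_{i,1}\times\dots\times\mathcal K_{i,m_i}\to\mathcal H_i$ multi-additive functors. Put $$F(G_1,\dots,G_n)(x_{1,1},\dots,x_{n,m_n}) = F\bigl(G_1(x_{1,1},\dots,x_{1,m_1}),\dots,G_n(x_{n,1},\dots,x_{n,m_n})\bigr),$$ with structure isomorphism in the variable $x_{i,a}$ obtained by composing $\lambda^i$ of $F$ with $F$ applied to $\lambda^a$ of $G_i$. Then $F(G_1,\dots,G_n)$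 is a multi-additive functor of the variables $x_{1,1},\dots,x_{n,m_n}$ (in lexicographic order); in particular it satisfies the interchange condition for every pair of variables. If moreover the $\mathcal K_{i,a}$ and the $G_i$ are braided, then $F(G_1,\dots,G_n)$ is braided. This composition is associative: $$F(G_1,\dots,G_n)(L_{1,1},\dots,L_{n,m_n}) = F\bigl(G_1(L_{1,1},\dots,L_{1,m_1}),\dots,G_n(L_{n,1},\dots,L_{n,m_n})\bigr).$$ The same statements hold for the stacks of multi-additive functors, that is, for every object $S$ of $\mathsf C$ and multi-additive functors between the restrictions of the given stacks to $\mathsf C/S$, and the composition commutes with restriction along morphisms $T\to S$. -/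

import Mathlib

open CategoryTheory MonoidalCategory Opposite Bicategory

universe w w' w'' t' t v' u' v u

noncomputable section

/-! ### Group-like stacks -/

namespace GrpLike

section Fibres

variable {C : Type u} [Category.{v} C] (X : LocallyDiscrete Cᵒᵖ ⥤ᵖ Cat.{v', u'})

/-- The fibre category of `X` over `S`. -/
abbrev Fib (S : C) : Type u' := X.obj (.mk (op S))

/-- Restriction (pullback) of objects of `X` along `f : T ⟶ S`. -/
abbrev res {S T : C} (f : T ⟶ S) : Fib X S ⥤ Fib X T := (X.map f.op.toLoc).toFunctor

/-- `f^* ≅ id` when `f` is an identity. -/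
def resId {S : C} (f : S ⟶ S) (hf : f = 𝟙 S) : res X f ≅ 𝟭 (Fib X S) :=
  Cat.Hom.toNatIso (X.mapId' f.op.toLoc (by subst hf; rfl))

/-- `h^* ≅ f^* ⋙ g^*` when `h = g ≫ f`. -/
def resComp {S T U : C} (f : T ⟶ S) (g : U ⟶ T) (h : U ⟶ S) (w : g ≫ f = h) :
    res X h ≅ res X f ⋙ res X g :=
  Cat.Hom.toNatIso (X.mapComp' f.op.toLoc g.op.toLoc h.op.toLoc (by subst w; rfl))

end Fibres

/-- A group-like stack on the site `(C, J)`: a stack in groupoids with a monoidal structure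
(the fibres are monoidal, the restriction functors and their coherence isomorphisms are monoidal,
which amounts to a stack morphism `m : X × X → X` with an associator and a unit) such that left
and right multiplication by every object is an equivalence. -/
structure GrStack {C : Type u} [Category.{v} C] (J : GrothendieckTopology C) where
  /-- the underlying stack -/
  X : LocallyDiscrete Cᵒᵖ ⥤ᵖ Cat.{v', u'}
  isStack : X.IsStack J
  isGroupoid : ∀ S : C, IsGroupoid (Fib X S)
  mon : ∀ S : C, MonoidalCategory (Fib X S)
  resMon : ∀ {S T : C} (f : T ⟶ S), (res X f).Monoidal
  resId_mon : ∀ {S : C} (f : S ⟶ S) (hf : f = 𝟙 S), NatTrans.IsMonoidal (resId X f hf).hom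
  resComp_mon : ∀ {S T U : C} (f : T ⟶ S) (g : U ⟶ T) (h : U ⟶ S) (w : g ≫ f = h),
    NatTrans.IsMonoidal (resComp X f g h w).hom
  left_equiv : ∀ {S : C} (x : Fib X S), (tensorLeft x).IsEquivalence
  right_equiv : ∀ {S : C} (x : Fib X S), (tensorRight x).IsEquivalence

attribute [instance] GrStack.isStack GrStack.isGroupoid GrStack.mon GrStack.resMon
  GrStack.left_equiv GrStack.right_equiv

/-- A braiding on a group-like stack: the fibres are braided and the restriction functors are
braided monoidal functors. -/
class Braiding {C : Type u} [Category.{v} C] {J : GrothendieckTopology C}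
    (G : GrStack.{v', u'} J) where
  [braided : ∀ S : C, BraidedCategory (Fib G.X S)]
  res_braided : ∀ {S T : C} (f : T ⟶ S) (a b : Fib G.X S),
    Functor.LaxMonoidal.μ (res G.X f) a b ≫ (res G.X f).map (β_ a b).hom =
      (β_ ((res G.X f).obj a) ((res G.X f).obj b)).hom ≫ Functor.LaxMonoidal.μ (res G.X f) b a

attribute [reducible, instance] Braiding.braided

/-! ### Substitution in one variable of a product of categories -/

section Products

variable {ι : Type w} (E : ι → Type u') [∀ i, Category.{v'} (E i)]

open Classical in
/-- The functor that inserts an object of `E i` as `i`-th coordinate next to given coordinates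
`j ≠ i`. -/
def ins (i : ι) : (∀ j : {j // j ≠ i}, E j) × E i ⥤ ∀ j, E j :=
  Functor.pi' fun j =>
    if h : j = i then CategoryTheory.Prod.snd _ _ ⋙ (Pi.eqToEquivalence E h.symm).functor
    else CategoryTheory.Prod.fst _ _ ⋙ Pi.eval (fun j : {j // j ≠ i} => E j) ⟨j, h⟩

variable {E}

/-- `a ↦ (x, a)`: insertion with the coordinates `j ≠ i` fixed. -/
def insAt (i : ι) (x : ∀ j : {j // j ≠ i}, E j) : E i ⥤ ∀ j, E j :=
  Functor.prod' ((Functor.const (E i)).obj x) (𝟭 (E i)) ⋙ ins E i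

/-- Insertion is natural in the fixed coordinates. -/
def insAtMap (i : ι) {x y : ∀ j : {j // j ≠ i}, E j} (φ : x ⟶ y) : insAt i x ⟶ insAt i y :=
  Functor.whiskerRight (NatTrans.prod' ((Functor.const (E i)).map φ) (𝟙 (𝟭 (E i)))) (ins E i)

/-- The coordinates `j ≠ i` of `z`. -/
abbrev others (i : ι) (z : ∀ j, E j) : ∀ j : {j // j ≠ i}, E j := fun j => z j

/-- `z` with its `i`-th coordinate replaced by `a`. -/
abbrev upd (i : ι) (z : ∀ j, E j) (a : E i) : ∀ j, E j := (insAt i (others i z)).obj a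

/-- The substitutions `i := a` and `j := b`, for `i ≠ j`, commute. -/
theorem upd_comm {i j : ι} (hij : i ≠ j) (z : ∀ j, E j) (a : E i) (b : E j) :
    upd i (upd j z b) a = upd j (upd i z a) b := by
  funext k
  simp only [upd, insAt, ins, Functor.comp_obj, Functor.pi'_obj]
  by_cases hi : k = i
  · subst hi
    simp [hij]
  · by_cases hj : k = j
    · subst hj
      simp [hi]
    · simp [hi, hj]

theorem insAt_eval_self (i : ι) (x : ∀ j : {j // j ≠ i}, E j) :
    insAt i x ⋙ Pi.eval E i = 𝟭 (E i) := by
  have h : ins E i ⋙ Pi.eval E i = CategoryTheory.Prod.snd _ _ := by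
    rw [ins, Functor.pi'_eval, dif_pos rfl]
    rfl
  rw [insAt, Functor.assoc, h]
  rfl

theorem insAt_eval_ne (i : ι) (x : ∀ j : {j // j ≠ i}, E j) (k : ι) (hk : k ≠ i) :
    insAt i x ⋙ Pi.eval E k = (Functor.const (E i)).obj (x ⟨k, hk⟩) := by
  have h : ins E i ⋙ Pi.eval E k = CategoryTheory.Prod.fst _ _ ⋙
      Pi.eval (fun j : {j // j ≠ i} => E j) ⟨k, hk⟩ := by
    rw [ins, Functor.pi'_eval, dif_neg hk]
  rw [insAt, Functor.assoc, h]
  rfl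

/-- Insertion commutes with a product of functors. -/
theorem insAt_comp_pi {E' : ι → Type u'} [∀ i, Category.{v'} (E' i)] (R : ∀ i, E i ⥤ E' i)
    (i : ι) (x : ∀ j : {j // j ≠ i}, E j) :
    insAt i x ⋙ Functor.pi R = R i ⋙ insAt i (fun j => (R j).obj (x j)) := by
  apply Functor.pi_ext
  intro k
  change (insAt i x ⋙ Pi.eval E k) ⋙ R k = R i ⋙ (insAt i _ ⋙ Pi.eval E' k)
  by_cases hk : k = i
  · subst hk
    rw [insAt_eval_self, insAt_eval_self]
    rfl
  · rw [insAt_eval_ne i _ k hk, insAt_eval_ne i _ k hk]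
    exact CategoryTheory.Functor.ext (fun _ => rfl) (fun _ _ _ => by simp)

variable {κ : ι → Type w'} {E' : (i : ι) → κ i → Type u'} [∀ i a, Category.{v'} (E' i a)]

/-- The coordinates of the `i`-th block of a family indexed by pairs. -/
def block (i : ι) : (∀ q : (i : ι) × κ i, E' q.1 q.2) ⥤ ∀ a, E' i a :=
  Functor.pi' fun a => Pi.eval (fun q : (i : ι) × κ i => E' q.1 q.2) ⟨i, a⟩

/-- A family of functors `R i : ∏ₐ E' i a ⥤ E i` applied to the blocks. -/
def blocks (R : ∀ i, (∀ a, E' i a) ⥤ E i) : (∀ q : (i : ι) × κ i, E' q.1 q.2) ⥤ ∀ i, E i :=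
  Functor.pi' fun i => block i ⋙ R i

/-- Isomorphisms `T i (R i x) ≅ R' i (T' i x)` applied to the blocks. -/
def blocksIso {E₂ : ι → Type u'} [∀ i, Category.{v'} (E₂ i)]
    {E₂' : (i : ι) → κ i → Type u'} [∀ i a, Category.{v'} (E₂' i a)]
    {R : ∀ i, (∀ a, E' i a) ⥤ E i} {R' : ∀ i, (∀ a, E₂' i a) ⥤ E₂ i}
    {T : ∀ i, E i ⥤ E₂ i} {T' : ∀ i a, E' i a ⥤ E₂' i a}
    (α : ∀ i, R i ⋙ T i ≅ Functor.pi (T' i) ⋙ R' i) :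
    blocks R ⋙ Functor.pi T ≅
      Functor.pi (fun q : (i : ι) × κ i => T' q.1 q.2) ⋙ blocks R' where
  hom :=
    { app := fun x i => (α i).hom.app ((block i).obj x)
      naturality := fun _ _ φ => funext fun i => (α i).hom.naturality ((block i).map φ) }
  inv :=
    { app := fun x i => (α i).inv.app ((block i).obj x)
      naturality := fun _ _ φ => funext fun i => (α i).inv.naturality ((block i).map φ) }
  hom_inv_id := by
    ext x i
    exact (α i).hom_inv_id_app ((block i).obj x)
  inv_hom_id := by
    ext x i
    exact (α i).inv_hom_id_app ((block i).obj x)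

/-- If the variable `q = (i, a)` varies and the others are fixed, then only the `i`-th value
of `blocks R` varies. -/
theorem insAt_comp_blocks (R : ∀ i, (∀ a, E' i a) ⥤ E i) (q : (i : ι) × κ i)
    (x : ∀ r : {r // r ≠ q}, E' r.1.1 r.1.2) :
    insAt (E := fun r : (i : ι) × κ i => E' r.1 r.2) q x ⋙ blocks R =
      (insAt (E := E' q.1) q.2
          (fun b => x ⟨⟨q.1, b⟩, fun h => b.2 (by cases q; simpa using h)⟩) ⋙ R q.1) ⋙
        insAt q.1 (fun j => (R j).obj
          fun b => x ⟨⟨j, b⟩, fun h => j.2 (congrArg Sigma.fst h)⟩) := by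
  obtain ⟨i, a⟩ := q
  apply Functor.pi_ext
  intro k
  change (insAt (E := fun r : (i : ι) × κ i => E' r.1 r.2) ⟨i, a⟩ x ⋙ block k) ⋙ R k =
    (insAt (E := E' i) a _ ⋙ R i) ⋙ (insAt i _ ⋙ Pi.eval E k)
  by_cases hk : k = i
  · subst hk
    rw [insAt_eval_self]
    congr 1
    apply Functor.pi_ext
    intro b
    change insAt (E := fun r : (i : ι) × κ i => E' r.1 r.2) ⟨k, a⟩ x ⋙
      Pi.eval (fun r : (i : ι) × κ i => E' r.1 r.2) ⟨k, b⟩ = _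
    by_cases hb : b = a
    · subst hb
      rw [insAt_eval_self, insAt_eval_self]
    · rw [insAt_eval_ne _ _ _ hb, insAt_eval_ne _ _ _ (by simpa using hb)]
  · rw [insAt_eval_ne _ _ _ hk]
    have : insAt (E := fun r : (i : ι) × κ i => E' r.1 r.2) ⟨i, a⟩ x ⋙ block k =
        (Functor.const _).obj
          (fun b => x ⟨⟨k, b⟩, fun h => hk (congrArg Sigma.fst h)⟩) := by
      apply Functor.pi_ext
      intro b
      change insAt (E := fun r : (i : ι) × κ i => E' r.1 r.2) ⟨i, a⟩ x ⋙
        Pi.eval (fun r : (i : ι) × κ i => E' r.1 r.2) ⟨k, b⟩ = _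
      rw [insAt_eval_ne _ _ _ (fun h => hk (congrArg Sigma.fst h))]
      rfl
    rw [this]
    exact CategoryTheory.Functor.ext (fun _ => rfl) (fun _ _ _ => by simp)

section Flatten

variable {μ : (i : ι) → κ i → Type w''} {A : (i : ι) → (a : κ i) → μ i a → Type u'}
  [∀ i a c, Category.{v'} (A i a c)]

/-- Passage between the index sets `((i, a), c)` and `(i, (a, c))`. -/
def flatten : (∀ q : (q : (i : ι) × κ i) × μ q.1 q.2, A q.1.1 q.1.2 q.2) ⥤
    ∀ q : (i : ι) × (a : κ i) × μ i a, A q.1 q.2.1 q.2.2 :=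
  Functor.pi' fun q => Pi.eval
    (fun q : (q : (i : ι) × κ i) × μ q.1 q.2 => A q.1.1 q.1.2 q.2) ⟨⟨q.1, q.2.1⟩, q.2.2⟩

theorem insAt_comp_flatten (q : (q : (i : ι) × κ i) × μ q.1 q.2)
    (x : ∀ r : {r // r ≠ q}, A r.1.1.1 r.1.1.2 r.1.2) :
    insAt (E := fun q : (q : (i : ι) × κ i) × μ q.1 q.2 => A q.1.1 q.1.2 q.2) q x ⋙ flatten =
      insAt (E := fun q : (i : ι) × (a : κ i) × μ i a => A q.1 q.2.1 q.2.2)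
        ⟨q.1.1, q.1.2, q.2⟩ (fun r => x ⟨⟨⟨r.1.1, r.1.2.1⟩, r.1.2.2⟩,
          fun h => r.2 (congrArg (fun s : (q : (i : ι) × κ i) × μ q.1 q.2 =>
            (⟨s.1.1, s.1.2, s.2⟩ : (i : ι) × (a : κ i) × μ i a)) h)⟩) := by
  obtain ⟨⟨i, a⟩, c⟩ := q
  apply Functor.pi_ext
  rintro ⟨j, b, c'⟩
  change insAt (E := fun q : (q : (i : ι) × κ i) × μ q.1 q.2 => A q.1.1 q.1.2 q.2) ⟨⟨i, a⟩, c⟩ x ⋙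
    Pi.eval (fun q : (q : (i : ι) × κ i) × μ q.1 q.2 => A q.1.1 q.1.2 q.2) ⟨⟨j, b⟩, c'⟩ = _
  by_cases h : (⟨⟨j, b⟩, c'⟩ : (q : (i : ι) × κ i) × μ q.1 q.2) = ⟨⟨i, a⟩, c⟩
  · cases h
    rw [insAt_eval_self, insAt_eval_self]
  · rw [insAt_eval_ne _ _ _ h, insAt_eval_ne _ _ _ (fun h' => h (by cases h'; rfl))]

end Flatten

end Products

/-! ### Multi-additive functors -/

section Multi

variable {C : Type u} [Category.{v} C] {J : GrothendieckTopology C}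
  {D : Type t} [Category.{t'} D]

/-- The data of a morphism `F : H₁ × ⋯ × Hₙ → G` of stacks which is additive (monoidal) in each
variable separately. The variables are indexed by `ι`. Everything is pulled back along a functor
`p : D ⥤ C`: for `p = 𝟭 C` one gets global morphisms, for `p = Over.forget S : Over S ⥤ C` one
gets the morphisms `H₁|_S × ⋯ × Hₙ|_S → G|_S` between the restrictions to the localized site
`C/S`, because the fibre of `G|_S` over `T ⟶ S` is that of `G` over `T`.

The isomorphisms `λⁱ : F(x, a) ⊗ F(x, a') ≅ F(x, a ⊗ a')` are the structure maps `μ` of the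
monoidal functor `a ↦ F(x, a)`, where `x` denotes the variables other than the `i`-th. -/
structure MultiFunctor {ι : Type w} (p : D ⥤ C) (H : ι → GrStack.{v', u'} J)
    (G : GrStack.{v', u'} J) where
  /-- the functor on the fibres over `p d` -/
  app (d : D) : (∀ i, Fib (H i).X (p.obj d)) ⥤ Fib G.X (p.obj d)
  /-- compatibility with restriction: `f^* F(x) ≅ F(f^* x)` -/
  resIso {d e : D} (f : d ⟶ e) : app e ⋙ res G.X (p.map f) ≅
    Functor.pi (fun i => res (H i).X (p.map f)) ⋙ app d
  /-- additivity in the `i`-th variable -/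
  mon (d : D) (i : ι) (x : ∀ j : {j // j ≠ i}, Fib (H j).X (p.obj d)) :
    (insAt (E := fun i => Fib (H i).X (p.obj d)) i x ⋙ app d).Monoidal

namespace MultiFunctor

attribute [instance] MultiFunctor.mon

variable {ι : Type w} {p : D ⥤ C} {H : ι → GrStack.{v', u'} J} {G : GrStack.{v', u'} J}
  (F : MultiFunctor p H G)

/-- The functor `a ↦ F(x, a)` of the `i`-th variable, the others being fixed. -/
abbrev partialFunctor (d : D) (i : ι) (x : ∀ j : {j // j ≠ i}, Fib (H j).X (p.obj d)) :
    Fib (H i).X (p.obj d) ⥤ Fib G.X (p.obj d) :=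
  insAt (E := fun i => Fib (H i).X (p.obj d)) i x ⋙ F.app d

/-- A morphism `φ : x ⟶ y` of the other variables induces `F(x, -) ⟶ F(y, -)`. -/
def partialMap (d : D) (i : ι) {x y : ∀ j : {j // j ≠ i}, Fib (H j).X (p.obj d)} (φ : x ⟶ y) :
    F.partialFunctor d i x ⟶ F.partialFunctor d i y :=
  Functor.whiskerRight (insAtMap (E := fun i => Fib (H i).X (p.obj d)) i φ) (F.app d)

/-- The isomorphism `f^* F(x, -) ≅ F(f^* x, f^* -)` induced by `resIso`. -/
def partialRes {d e : D} (f : d ⟶ e) (i : ι)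
    (x : ∀ j : {j // j ≠ i}, Fib (H j).X (p.obj e)) :
    F.partialFunctor e i x ⋙ res G.X (p.map f) ≅
      res (H i).X (p.map f) ⋙
        F.partialFunctor d i (fun j => (res (H j).X (p.map f)).obj (x j)) :=
  Functor.associator _ _ _ ≪≫
    Functor.isoWhiskerLeft (insAt (E := fun i => Fib (H i).X (p.obj e)) i x) (F.resIso f) ≪≫
    (Functor.associator _ _ _).symm ≪≫
    Functor.isoWhiskerRight
      (eqToIso (insAt_comp_pi (E := fun i => Fib (H i).X (p.obj e))
        (fun i => res (H i).X (p.map f)) i x)) (F.app d) ≪≫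
    Functor.associator _ _ _

/-- `F` of the family `z` with `z i` replaced by `a` and `z j` replaced by `b`. The value does not
depend on the order of the two substitutions; `swap` is the resulting identification. -/
def swap (d : D) {i j : ι} (hij : i ≠ j) (z : ∀ k, Fib (H k).X (p.obj d))
    (a : Fib (H i).X (p.obj d)) (b : Fib (H j).X (p.obj d)) :
    (F.app d).obj (upd i (upd j z b) a) ≅ (F.app d).obj (upd j (upd i z a) b) :=
  (F.app d).mapIso (eqToIso (upd_comm (E := fun i => Fib (H i).X (p.obj d)) hij z a b))

/-- `λⁱ_{a, a'} : F(z, a) ⊗ F(z, a') ⟶ F(z, a ⊗ a')`. -/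
abbrev lam (d : D) (i : ι) (z : ∀ k, Fib (H k).X (p.obj d)) (a a' : Fib (H i).X (p.obj d)) :
    (F.app d).obj (upd i z a) ⊗ (F.app d).obj (upd i z a') ⟶ (F.app d).obj (upd i z (a ⊗ a')) :=
  Functor.LaxMonoidal.μ (F.partialFunctor d i (others i z)) a a'

/-- `εⁱ : I ⟶ F(z, I)`, the unit isomorphism in the `i`-th variable. Since the fibres are
group-like, it is determined by `λⁱ`. -/
abbrev unit (d : D) (i : ι) (z : ∀ k, Fib (H k).X (p.obj d)) :
    𝟙_ (Fib G.X (p.obj d)) ⟶ (F.app d).obj (upd i z (𝟙_ _)) :=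
  Functor.LaxMonoidal.ε (F.partialFunctor d i (others i z))

/-- `F` is a multi-additive functor; `r` is the order of the variables. -/
structure IsMultiAdditive [Braiding G] (r : ι → ι → Prop) : Prop where
  /-- `F` is a morphism of stacks (pseudonatural) -/
  resIso_id (d : D) (x : ∀ i, Fib (H i).X (p.obj d)) :
    (F.resIso (𝟙 d)).hom.app x ≫
        (F.app d).map (fun i => (resId (H i).X (p.map (𝟙 d)) (p.map_id d)).hom.app (x i)) =
      (resId G.X (p.map (𝟙 d)) (p.map_id d)).hom.app ((F.app d).obj x)
  resIso_comp {d e e' : D} (f : d ⟶ e) (g : e ⟶ e') (x : ∀ i, Fib (H i).X (p.obj e')) :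
    (F.resIso (f ≫ g)).hom.app x ≫
        (F.app d).map (fun i => (resComp (H i).X (p.map g) (p.map f) (p.map (f ≫ g))
          (p.map_comp f g).symm).hom.app (x i)) =
      (resComp G.X (p.map g) (p.map f) (p.map (f ≫ g)) (p.map_comp f g).symm).hom.app
          ((F.app e').obj x) ≫
        (res G.X (p.map f)).map ((F.resIso g).hom.app x) ≫
          (F.resIso f).hom.app (fun i => (res (H i).X (p.map g)).obj (x i))
  /-- `λⁱ` is functorial in the variables other than the `i`-th -/
  natural (d : D) (i : ι) {x y : ∀ j : {j // j ≠ i}, Fib (H j).X (p.obj d)} (φ : x ⟶ y) :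
    NatTrans.IsMonoidal (F.partialMap d i φ)
  /-- `λⁱ` is compatible with restriction -/
  natural_res {d e : D} (f : d ⟶ e) (i : ι)
    (x : ∀ j : {j // j ≠ i}, Fib (H j).X (p.obj e)) :
    NatTrans.IsMonoidal (F.partialRes f i x).hom
  /-- the interchange condition for the variables `i`, `j` -/
  interchange (d : D) (i j : ι) (_ : r i j) (hij : i ≠ j) (z : ∀ k, Fib (H k).X (p.obj d))
    (a a' : Fib (H i).X (p.obj d)) (b b' : Fib (H j).X (p.obj d)) :
    (F.lam d i (upd j z b) a a' ⊗ₘ F.lam d i (upd j z b') a a') ≫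
        ((F.swap d hij z (a ⊗ a') b).hom ⊗ₘ (F.swap d hij z (a ⊗ a') b').hom) ≫
          F.lam d j (upd i z (a ⊗ a')) b b' =
      tensorμ _ _ _ _ ≫
        (((F.swap d hij z a b).hom ⊗ₘ (F.swap d hij z a b').hom) ⊗ₘ
          ((F.swap d hij z a' b).hom ⊗ₘ (F.swap d hij z a' b').hom)) ≫
        (F.lam d j (upd i z a) b b' ⊗ₘ F.lam d j (upd i z a') b b') ≫
        ((F.swap d hij z a (b ⊗ b')).inv ⊗ₘ (F.swap d hij z a' (b ⊗ b')).inv) ≫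
          F.lam d i (upd j z (b ⊗ b')) a a' ≫ (F.swap d hij z (a ⊗ a') (b ⊗ b')).hom
  /-- the two isomorphisms `I ⟶ F(…, I, …, I, …)` for the variables `i`, `j` coincide -/
  unit_eq (d : D) (i j : ι) (_ : r i j) (hij : i ≠ j) (z : ∀ k, Fib (H k).X (p.obj d)) :
    F.unit d i (upd j z (𝟙_ _)) ≫ (F.swap d hij z (𝟙_ _) (𝟙_ _)).hom = F.unit d j (upd i z (𝟙_ _))

/-- `F` is braided in each variable. -/
def IsBraided [∀ i, Braiding (H i)] [Braiding G] : Prop :=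
  ∀ (d : D) (i : ι) (z : ∀ k, Fib (H k).X (p.obj d)) (a a' : Fib (H i).X (p.obj d)),
    F.lam d i z a a' ≫ (F.partialFunctor d i (others i z)).map (β_ a a').hom =
      (β_ ((F.app d).obj (upd i z a)) ((F.app d).obj (upd i z a'))).hom ≫ F.lam d i z a' a

/-- Pullback along `q : D' ⥤ D`. -/
def pull {D' : Type*} [Category* D'] (q : D' ⥤ D) : MultiFunctor (q ⋙ p) H G where
  app d := F.app (q.obj d)
  resIso f := F.resIso (q.map f)
  mon d i x := F.mon (q.obj d) i x

section Comp

variable {κ : ι → Type w'} {K : (i : ι) → κ i → GrStack.{v', u'} J}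

/-- The composition `F(G₁, …, Gₙ)`, with variables indexed by the pairs `(i, a)`, `a ∈ κ i`:
`F(G₁, …, Gₙ)(x) = F(G₁(x₁,₁, …), …, Gₙ(…, xₙ,ₘ))`. Its `λ` in the variable `(i, a)` is
`F(…, λᵃ of Gᵢ, …) ∘ (λⁱ of F)`. -/
def comp (P : ∀ i, MultiFunctor p (K i) (H i)) :
    MultiFunctor p (fun q : (i : ι) × κ i => K q.1 q.2) G where
  app d := blocks (E' := fun i a => Fib (K i a).X (p.obj d)) (fun i => (P i).app d) ⋙ F.app d
  resIso {d e} f :=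
    Functor.associator _ _ _ ≪≫
      Functor.isoWhiskerLeft
        (blocks (E' := fun i a => Fib (K i a).X (p.obj e)) (fun i => (P i).app e))
        (F.resIso f) ≪≫
      (Functor.associator _ _ _).symm ≪≫
      Functor.isoWhiskerRight
        (blocksIso (E' := fun i a => Fib (K i a).X (p.obj e))
          (T := fun i => res (H i).X (p.map f)) (T' := fun i a => res (K i a).X (p.map f))
          (fun i => (P i).resIso f)) (F.app d) ≪≫
      Functor.associator _ _ _
  mon d q x :=
    Functor.Monoidal.transport
      (F := (P q.1).partialFunctor d q.2 _ ⋙ F.partialFunctor d q.1 _)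
      (Functor.isoWhiskerRight (eqToIso (insAt_comp_blocks
        (E := fun i => Fib (H i).X (p.obj d)) (E' := fun i a => Fib (K i a).X (p.obj d))
        (fun i => (P i).app d) q x).symm) (F.app d))

/-- Relabelling of variables: a functor of the variables `(i, (a, c))` seen as a functor of the
variables `((i, a), c)`. (The two lexicographic orders agree.) -/
def relabel {μ : (i : ι) → κ i → Type w''} {L : (i : ι) → (a : κ i) → μ i a → GrStack.{v', u'} J}
    (F : MultiFunctor p (fun q : (i : ι) × (a : κ i) × μ i a => L q.1 q.2.1 q.2.2) G) :
    MultiFunctor p (fun q : (q : (i : ι) × κ i) × μ q.1 q.2 => L q.1.1 q.1.2 q.2) G where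
  app d := flatten (A := fun i a c => Fib (L i a c).X (p.obj d)) ⋙ F.app d
  resIso {_ e} f :=
    Functor.isoWhiskerLeft (flatten (A := fun i a c => Fib (L i a c).X (p.obj e))) (F.resIso f)
  mon d q x :=
    letI := F.mon d ⟨q.1.1, q.1.2, q.2⟩ (fun r => x ⟨⟨⟨r.1.1, r.1.2.1⟩, r.1.2.2⟩,
      fun h => r.2 (congrArg (fun s : (q : (i : ι) × κ i) × μ q.1 q.2 =>
        (⟨s.1.1, s.1.2, s.2⟩ : (i : ι) × (a : κ i) × μ i a)) h)⟩)
    Functor.Monoidal.transport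
      (Functor.isoWhiskerRight (eqToIso (insAt_comp_flatten
        (A := fun i a c => Fib (L i a c).X (p.obj d)) q x).symm) (F.app d))

end Comp

end MultiFunctor
end Multi
end GrpLike

end

noncomputable section

namespace GrpLike

/-! ### Morphisms into and out of an insertion -/

section Insertion

variable {ι : Type w} {E : ι → Type u'} [∀ i, Category.{v'} (E i)]

/-! Take two variables $x_{i,a}$ and $x_{j,b}$ of the composite. If $i\ne j$, their interchange is
that of $F$ in the variables $i,j$, evaluated at the values of $G_i$ and $G_j$: the isomorphisms
$\lambda$ of $G_i$ and $G_j$ slide past those of $F$, because the latter are functorial in all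
variables. If $i=j$, both orders of addition use the same monoidal functor $y\mapsto
F(\dots,y,\dots)$, applied to the two sides of the interchange for $G_i$. Those sides differ by
$\hat c$ of $\mathcal H_i$, and the functor carries it to $\hat c$ of $\mathcal G$ precisely because
$F$ is braided. This is where braidedness of $F$ enters. The unit condition has the same two cases,
and braidedness of the composite is the fact that a composite of braided functors is braided.

The technical obstacle is that families such as `upd i (upd j z b) a` and `upd j (upd i z a) b` are
only propositionally equal. The proof therefore replaces $\lambda^i$ by `addHom Φ i α β γ`, defined
for arbitrary families `u`, `v`, `w`, with arbitrary morphisms into `w` in the coordinates other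
than `i`. By `IsNaturalInOthers.map_μ_map` every composite of a structure morphism with images of
morphisms is an `addHom` whose components are the evident composites, so identities between
structure morphisms can be checked coordinate by coordinate.

Interchange is translated into this language and back by `InsInterchange.addInterchange` and
`AddInterchange.insInterchange`. By `addHom_blocks` the `addHom` of a composite is an `addHom` of
$F$ whose `i`-th component is an `addHom` of $G_i$. The two cases above are
`blocks_addInterchange_of_ne` and `blocks_addInterchange_of_eq`. Compatibility with restriction is
`isAddCompatible_blocks`, the braiding is `blocks_braided`, and associativity reduces to
`blocksMonoidal_assoc`, where both structures are expanded to the same nested form. -/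

theorem insAt_obj_self (i : ι) (x : ∀ j : {j // j ≠ i}, E j) (a : E i) :
    (insAt i x).obj a i = a :=
  Functor.congr_obj (insAt_eval_self i x) a

theorem insAt_obj_ne (i : ι) (x : ∀ j : {j // j ≠ i}, E j) (a : E i) (k : ι) (hk : k ≠ i) :
    (insAt i x).obj a k = x ⟨k, hk⟩ :=
  Functor.congr_obj (insAt_eval_ne i x k hk) a

theorem insAt_map_self (i : ι) (x : ∀ j : {j // j ≠ i}, E j) {a b : E i} (f : a ⟶ b) :
    (insAt i x).map f i =
      eqToHom (insAt_obj_self i x a) ≫ f ≫ eqToHom (insAt_obj_self i x b).symm :=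
  Functor.congr_hom (insAt_eval_self i x) f

theorem insAt_map_ne (i : ι) (x : ∀ j : {j // j ≠ i}, E j) {a b : E i} (f : a ⟶ b)
    (k : ι) (hk : k ≠ i) :
    (insAt i x).map f k =
      eqToHom ((insAt_obj_ne i x a k hk).trans (insAt_obj_ne i x b k hk).symm) := by
  have := Functor.congr_hom (insAt_eval_ne i x k hk) f
  exact this.trans (by simp; rfl)

theorem insAtMap_app_self (i : ι) {x y : ∀ j : {j // j ≠ i}, E j} (φ : x ⟶ y) (a : E i) :
    (insAtMap i φ).app a i =
      eqToHom ((insAt_obj_self i x a).trans (insAt_obj_self i y a).symm) := by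
  have h : ins E i ⋙ Pi.eval E i = CategoryTheory.Prod.snd _ _ := by
    rw [ins, Functor.pi'_eval, dif_pos rfl]
    rfl
  have := Functor.congr_hom h (show (x, a) ⟶ (y, a) from (φ, 𝟙 a))
  exact this.trans (by simp; rfl)

theorem insAtMap_app_ne (i : ι) {x y : ∀ j : {j // j ≠ i}, E j} (φ : x ⟶ y) (a : E i)
    (k : ι) (hk : k ≠ i) :
    (insAtMap i φ).app a k =
      eqToHom (insAt_obj_ne i x a k hk) ≫ φ ⟨k, hk⟩ ≫
        eqToHom (insAt_obj_ne i y a k hk).symm := by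
  have h : ins E i ⋙ Pi.eval E k = CategoryTheory.Prod.fst _ _ ⋙
      Pi.eval (fun j : {j // j ≠ i} => E j) ⟨k, hk⟩ := by
    rw [ins, Functor.pi'_eval, dif_neg hk]
  exact Functor.congr_hom h (show (x, a) ⟶ (y, a) from (φ, 𝟙 a))

theorem pi_eqToHom_apply {u v : ∀ i, E i} (h : u = v) (k : ι) :
    (eqToHom h : u ⟶ v) k = eqToHom (congrFun h k) := by
  subst h
  rfl

open Classical in
/-- The morphism of families with the component `f` at `i` and the components `α` elsewhere. -/
def glue (i : ι) {u w : ∀ k, E k} (α : ∀ k, k ≠ i → (u k ⟶ w k)) (f : u i ⟶ w i) : u ⟶ w :=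
  fun k => if h : k = i then Eq.rec (motive := fun k _ => u k ⟶ w k) f h.symm else α k h

@[simp]
theorem glue_self (i : ι) {u w : ∀ k, E k} (α : ∀ k, k ≠ i → (u k ⟶ w k)) (f : u i ⟶ w i) :
    glue i α f i = f := by
  simp [glue]

@[simp]
theorem glue_ne (i : ι) {u w : ∀ k, E k} (α : ∀ k, k ≠ i → (u k ⟶ w k)) (f : u i ⟶ w i)
    (k : ι) (hk : k ≠ i) : glue i α f k = α k hk := by
  simp [glue, hk]

theorem hom_ext_at (i : ι) {u w : ∀ k, E k} {f g : u ⟶ w} (h : f i = g i)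
    (h' : ∀ k, k ≠ i → f k = g k) : f = g := by
  funext k
  by_cases hk : k = i
  · subst hk
    exact h
  · exact h' k hk

end Insertion

/-! ### Functors of several variables which are monoidal in each variable -/

section Fibrewise

variable {ι : Type w} {E : ι → Type u'} [∀ i, Category.{v'} (E i)] [∀ i, MonoidalCategory (E i)]
  {A : Type u'} [Category.{v'} A] [MonoidalCategory A] (Φ : (∀ i, E i) ⥤ A)
  [∀ i x, (insAt i x ⋙ Φ).LaxMonoidal]

open Functor.LaxMonoidal (μ μ_natural)

/-- The morphism `Φ u ⊗ Φ v ⟶ Φ w` determined by the additivity of `Φ` in the `i`-th variable,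
by morphisms `u k ⟶ w k` and `v k ⟶ w k` for `k ≠ i`, and by `u i ⊗ v i ⟶ w i`. -/
def addHom (i : ι) {u v w : ∀ k, E k} (α : ∀ k, k ≠ i → (u k ⟶ w k))
    (β : ∀ k, k ≠ i → (v k ⟶ w k)) (γ : u i ⊗ v i ⟶ w i) : Φ.obj u ⊗ Φ.obj v ⟶ Φ.obj w :=
  (Φ.map (glue i (w := (insAt i (others i w)).obj (u i))
      (fun k hk => α k hk ≫ eqToHom (insAt_obj_ne i (others i w) _ k hk).symm)
      (eqToHom (insAt_obj_self i _ _).symm)) ⊗ₘ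
    Φ.map (glue i (w := (insAt i (others i w)).obj (v i))
      (fun k hk => β k hk ≫ eqToHom (insAt_obj_ne i (others i w) _ k hk).symm)
      (eqToHom (insAt_obj_self i _ _).symm))) ≫
  μ (insAt i (others i w) ⋙ Φ) (u i) (v i) ≫
  Φ.map (glue i (u := (insAt i (others i w)).obj (u i ⊗ v i))
      (fun k hk => eqToHom (insAt_obj_ne i _ _ k hk))
      (eqToHom (insAt_obj_self i _ _) ≫ γ))

/-- The morphism `𝟙_ ⟶ Φ w` determined by the additivity of `Φ` in the `i`-th variable
and by `𝟙_ ⟶ w i`. -/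
def unitHom (i : ι) {w : ∀ k, E k} (γ : 𝟙_ (E i) ⟶ w i) : 𝟙_ A ⟶ Φ.obj w :=
  Functor.LaxMonoidal.ε (insAt i (others i w) ⋙ Φ) ≫
  Φ.map (glue i (u := (insAt i (others i w)).obj (𝟙_ _))
      (fun k hk => eqToHom (insAt_obj_ne i _ _ k hk))
      (eqToHom (insAt_obj_self i _ _) ≫ γ))

/-- The structure morphisms in each variable are natural in the other variables. -/
def IsNaturalInOthers : Prop :=
  ∀ (i : ι) {x y : ∀ j : {j // j ≠ i}, E j} (φ : x ⟶ y),
    NatTrans.IsMonoidal (Functor.whiskerRight (insAtMap i φ) Φ)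

variable {Φ}

namespace IsNaturalInOthers

/-- The normal form on which everything rests. Naturality in the other variables replaces the
parameters `x` by those of the target `w`, and naturality of `μ` moves the `i`-th components of `f`
and `g` to its far side. What remains depends only on the composites through each coordinate. -/
theorem map_μ_map (hΦ : IsNaturalInOthers Φ) (i : ι) {x : ∀ j : {j // j ≠ i}, E j}
    {a a' : E i} {u v w : ∀ k, E k} (f : u ⟶ (insAt i x).obj a) (g : v ⟶ (insAt i x).obj a')
    (h : (insAt i x).obj (a ⊗ a') ⟶ w) :
    (Φ.map f ⊗ₘ Φ.map g) ≫ μ (insAt i x ⋙ Φ) a a' ≫ Φ.map h =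
      addHom Φ i
        (fun k hk => f k ≫ eqToHom ((insAt_obj_ne i x _ k hk).trans
          (insAt_obj_ne i x _ k hk).symm) ≫ h k)
        (fun k hk => g k ≫ eqToHom ((insAt_obj_ne i x _ k hk).trans
          (insAt_obj_ne i x _ k hk).symm) ≫ h k)
        (((f i ≫ eqToHom (insAt_obj_self i x a)) ⊗ₘ (g i ≫ eqToHom (insAt_obj_self i x a'))) ≫
          eqToHom (insAt_obj_self i x _).symm ≫ h i) := by
  -- `h` splits into a change `φ` of the fixed coordinates, from `x` to those of `w`, followed by a
  -- morphism that is essentially the identity outside `i`.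
  let y := others i w
  let φ : x ⟶ y := fun j => eqToHom (insAt_obj_ne i x (a ⊗ a') j.1 j.2).symm ≫ h j.1
  have hh : h = (insAtMap i φ).app (a ⊗ a') ≫
      glue i (u := (insAt i y).obj (a ⊗ a')) (fun k hk => eqToHom (insAt_obj_ne i _ _ k hk))
      (eqToHom (insAt_obj_self i _ _) ≫ eqToHom (insAt_obj_self i x _).symm ≫ h i) := by
    apply hom_ext_at i
    · simp [insAtMap_app_self]
    · intro k hk
      simp [insAtMap_app_ne _ _ _ _ hk, φ, hk]
  have e1 := (hΦ i φ).tensor a a'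
  dsimp only [Functor.whiskerRight_app] at e1
  unfold addHom
  change _ = _ ≫ μ (insAt i y ⋙ Φ) (u i) (v i) ≫ _
  set f' := f i ≫ eqToHom (insAt_obj_self i x a) with hf'
  set g' := g i ≫ eqToHom (insAt_obj_self i x a') with hg'
  have e2 : glue i (u := (insAt i y).obj (u i ⊗ v i)) (w := w)
      (fun k hk => eqToHom (insAt_obj_ne i _ _ k hk))
      (eqToHom (insAt_obj_self i _ _) ≫ (f' ⊗ₘ g') ≫ eqToHom (insAt_obj_self i x _).symm ≫ h i) =
      (insAt i y).map (f' ⊗ₘ g') ≫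
        glue i (u := (insAt i y).obj (a ⊗ a')) (fun k hk => eqToHom (insAt_obj_ne i _ _ k hk))
      (eqToHom (insAt_obj_self i _ _) ≫ eqToHom (insAt_obj_self i x _).symm ≫ h i) := by
    apply hom_ext_at i
    · simp [insAt_map_self]
    · intro k hk
      simp [insAt_map_ne _ _ _ _ hk, hk]
  rw [e2, Φ.map_comp]
  have e3 := μ_natural (insAt i y ⋙ Φ) f' g'
  dsimp only [Functor.comp_map] at e3
  rw [reassoc_of% e3.symm]
  conv_lhs => rw [hh]
  rw [Φ.map_comp, reassoc_of% e1]
  simp only [← Category.assoc]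
  congr 2
  simp only [tensorHom_comp_tensorHom, ← Φ.map_comp]
  congr 2
  · apply hom_ext_at i
    · simp [insAtMap_app_self, insAt_map_self, f']
    · intro k hk
      simp [insAtMap_app_ne _ _ _ _ hk, insAt_map_ne _ _ _ _ hk, hk, φ]
  · apply hom_ext_at i
    · simp [insAtMap_app_self, insAt_map_self, g']
    · intro k hk
      simp [insAtMap_app_ne _ _ _ _ hk, insAt_map_ne _ _ _ _ hk, hk, φ]

theorem ε_map (hΦ : IsNaturalInOthers Φ) (i : ι) {x : ∀ j : {j // j ≠ i}, E j} {w : ∀ k, E k}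
    (h : (insAt i x).obj (𝟙_ _) ⟶ w) :
    Functor.LaxMonoidal.ε (insAt i x ⋙ Φ) ≫ Φ.map h =
      unitHom Φ i (eqToHom (insAt_obj_self i x _).symm ≫ h i) := by
  let φ : x ⟶ others i w := fun j =>
    eqToHom (insAt_obj_ne i x (𝟙_ _) j.1 j.2).symm ≫ h j.1
  have hh : h = (insAtMap i φ).app (𝟙_ _) ≫
      glue i (u := (insAt i (others i w)).obj (𝟙_ _))
        (fun k hk => eqToHom (insAt_obj_ne i _ _ k hk))
      (eqToHom (insAt_obj_self i _ _) ≫ eqToHom (insAt_obj_self i x _).symm ≫ h i) := by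
    apply hom_ext_at i
    · simp [insAtMap_app_self]
    · intro k hk
      simp [insAtMap_app_ne _ _ _ _ hk, φ, hk]
  have e1 := (hΦ i φ).unit
  dsimp only [Functor.whiskerRight_app] at e1
  conv_lhs => rw [hh]
  rw [Φ.map_comp, reassoc_of% e1]
  rfl

/-- The class of `addHom` morphisms absorbs morphisms on both sides; this is `map_μ_map` applied to
the three factors in the definition. -/
theorem map_addHom_map (hΦ : IsNaturalInOthers Φ) (i : ι) {u v w u' v' w' : ∀ k, E k}
    (f : u' ⟶ u) (g : v' ⟶ v) (h : w ⟶ w')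
    (α : ∀ k, k ≠ i → (u k ⟶ w k)) (β : ∀ k, k ≠ i → (v k ⟶ w k)) (γ : u i ⊗ v i ⟶ w i) :
    (Φ.map f ⊗ₘ Φ.map g) ≫ addHom Φ i α β γ ≫ Φ.map h =
      addHom Φ i (fun k hk => f k ≫ α k hk ≫ h k) (fun k hk => g k ≫ β k hk ≫ h k)
        ((f i ⊗ₘ g i) ≫ γ ≫ h i) := by
  conv_lhs => unfold addHom
  simp only [Category.assoc, tensorHom_comp_tensorHom_assoc, ← Φ.map_comp]
  rw [hΦ.map_μ_map]
  congr 1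
  · funext k hk
    simp [hk]
  · funext k hk
    simp [hk]
  · simp

theorem unitHom_map (hΦ : IsNaturalInOthers Φ) (i : ι) {w w' : ∀ k, E k} (h : w ⟶ w')
    (γ : 𝟙_ (E i) ⟶ w i) :
    unitHom Φ i γ ≫ Φ.map h = unitHom Φ i (γ ≫ h i) := by
  conv_lhs => unfold unitHom
  rw [Category.assoc, ← Φ.map_comp, hΦ.ε_map]
  simp

end IsNaturalInOthers

end Fibrewise

/-! ### Interchange for additions with arbitrary comparison morphisms. -/

section Interchange

variable {ι : Type w} {E : ι → Type u'} [∀ i, Category.{v'} (E i)] [∀ i, MonoidalCategory (E i)]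
  {A : Type u'} [Category.{v'} A] [MonoidalCategory A] (Φ : (∀ i, E i) ⥤ A)
  [∀ i x, (insAt i x ⋙ Φ).LaxMonoidal]

open Functor.LaxMonoidal (μ μ_natural)

theorem tensorHom_eqToHom {B : Type*} [Category* B] [MonoidalCategory B] {a a' b b' : B}
    (ha : a = b) (hb : a' = b') :
    (eqToHom ha ⊗ₘ eqToHom hb) = eqToHom (congrArg₂ tensorObj ha hb) := by
  subst ha hb
  simp

/-- The interchange condition for the morphisms `addHom` in the variables `i` and `j`. -/
def AddInterchange [BraidedCategory A] (i j : ι) : Prop :=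
  ∀ ⦃x₀₀ x₁₀ x₀₁ x₁₁ y₀ y₁ z₀ z₁ w : ∀ k, E k⦄
    (p₀₀ : ∀ k, k ≠ i → (x₀₀ k ⟶ y₀ k)) (p₁₀ : ∀ k, k ≠ i → (x₁₀ k ⟶ y₀ k))
    (γ₀ : x₀₀ i ⊗ x₁₀ i ⟶ y₀ i)
    (p₀₁ : ∀ k, k ≠ i → (x₀₁ k ⟶ y₁ k)) (p₁₁ : ∀ k, k ≠ i → (x₁₁ k ⟶ y₁ k))
    (γ₁ : x₀₁ i ⊗ x₁₁ i ⟶ y₁ i)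
    (p₀ : ∀ k, k ≠ j → (y₀ k ⟶ w k)) (p₁ : ∀ k, k ≠ j → (y₁ k ⟶ w k)) (γ : y₀ j ⊗ y₁ j ⟶ w j)
    (q₀₀ : ∀ k, k ≠ j → (x₀₀ k ⟶ z₀ k)) (q₀₁ : ∀ k, k ≠ j → (x₀₁ k ⟶ z₀ k))
    (δ₀ : x₀₀ j ⊗ x₀₁ j ⟶ z₀ j)
    (q₁₀ : ∀ k, k ≠ j → (x₁₀ k ⟶ z₁ k)) (q₁₁ : ∀ k, k ≠ j → (x₁₁ k ⟶ z₁ k))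
    (δ₁ : x₁₀ j ⊗ x₁₁ j ⟶ z₁ j)
    (q₀ : ∀ k, k ≠ i → (z₀ k ⟶ w k)) (q₁ : ∀ k, k ≠ i → (z₁ k ⟶ w k)) (δ : z₀ i ⊗ z₁ i ⟶ w i)
    (hij : i ≠ j)
    (_ : ∀ k (hi : k ≠ i) (hj : k ≠ j), p₀₀ k hi ≫ p₀ k hj = q₀₀ k hj ≫ q₀ k hi)
    (_ : ∀ k (hi : k ≠ i) (hj : k ≠ j), p₁₀ k hi ≫ p₀ k hj = q₁₀ k hj ≫ q₁ k hi)
    (_ : ∀ k (hi : k ≠ i) (hj : k ≠ j), p₀₁ k hi ≫ p₁ k hj = q₀₁ k hj ≫ q₀ k hi)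
    (_ : ∀ k (hi : k ≠ i) (hj : k ≠ j), p₁₁ k hi ≫ p₁ k hj = q₁₁ k hj ≫ q₁ k hi)
    (_ : γ₀ ≫ p₀ i hij = (q₀₀ i hij ⊗ₘ q₁₀ i hij) ≫ δ)
    (_ : γ₁ ≫ p₁ i hij = (q₀₁ i hij ⊗ₘ q₁₁ i hij) ≫ δ)
    (_ : δ₀ ≫ q₀ j hij.symm = (p₀₀ j hij.symm ⊗ₘ p₀₁ j hij.symm) ≫ γ)
    (_ : δ₁ ≫ q₁ j hij.symm = (p₁₀ j hij.symm ⊗ₘ p₁₁ j hij.symm) ≫ γ),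
    (addHom Φ i p₀₀ p₁₀ γ₀ ⊗ₘ addHom Φ i p₀₁ p₁₁ γ₁) ≫ addHom Φ j p₀ p₁ γ =
      tensorμ _ _ _ _ ≫ (addHom Φ j q₀₀ q₀₁ δ₀ ⊗ₘ addHom Φ j q₁₀ q₁₁ δ₁) ≫ addHom Φ i q₀ q₁ δ

/-- The interchange condition for the structure morphisms in the variables `i` and `j`. -/
def InsInterchange [BraidedCategory A] (i j : ι) (hij : i ≠ j) : Prop :=
  ∀ (z : ∀ k, E k) (a a' : E i) (b b' : E j),
    (μ (insAt i (others i (upd j z b)) ⋙ Φ) a a' ⊗ₘ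
        μ (insAt i (others i (upd j z b')) ⋙ Φ) a a') ≫
      (Φ.map (eqToHom (upd_comm hij z (a ⊗ a') b)) ⊗ₘ
        Φ.map (eqToHom (upd_comm hij z (a ⊗ a') b'))) ≫
      μ (insAt j (others j (upd i z (a ⊗ a'))) ⋙ Φ) b b' =
    tensorμ _ _ _ _ ≫
      ((Φ.map (eqToHom (upd_comm hij z a b)) ⊗ₘ Φ.map (eqToHom (upd_comm hij z a b'))) ⊗ₘ
        (Φ.map (eqToHom (upd_comm hij z a' b)) ⊗ₘ Φ.map (eqToHom (upd_comm hij z a' b')))) ≫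
      (μ (insAt j (others j (upd i z a)) ⋙ Φ) b b' ⊗ₘ
        μ (insAt j (others j (upd i z a')) ⋙ Φ) b b') ≫
      (Φ.map (eqToHom (upd_comm hij z a (b ⊗ b')).symm) ⊗ₘ
        Φ.map (eqToHom (upd_comm hij z a' (b ⊗ b')).symm)) ≫
      μ (insAt i (others i (upd j z (b ⊗ b'))) ⋙ Φ) a a' ≫
        Φ.map (eqToHom (upd_comm hij z (a ⊗ a') (b ⊗ b')))

variable {Φ}

/-- Addition in `i` followed by addition in `j` does not depend on the intermediate families chosen:
only the composite components matter, up to a change `e₀`, `e₁` of the `j`-th coordinates. This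
allows the intermediate families to be replaced by ones obtained from `w` by substitution. -/
theorem IsNaturalInOthers.addHom_comp_congr (hΦ : IsNaturalInOthers Φ) {i j : ι} (hij : i ≠ j)
    {x₀₀ x₁₀ x₀₁ x₁₁ y₀ y₁ z₀ z₁ w : ∀ k, E k}
    (p₀₀ : ∀ k, k ≠ i → (x₀₀ k ⟶ y₀ k)) (p₁₀ : ∀ k, k ≠ i → (x₁₀ k ⟶ y₀ k))
    (γ₀ : x₀₀ i ⊗ x₁₀ i ⟶ y₀ i)
    (p₀₁ : ∀ k, k ≠ i → (x₀₁ k ⟶ y₁ k)) (p₁₁ : ∀ k, k ≠ i → (x₁₁ k ⟶ y₁ k))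
    (γ₁ : x₀₁ i ⊗ x₁₁ i ⟶ y₁ i)
    (p₀ : ∀ k, k ≠ j → (y₀ k ⟶ w k)) (p₁ : ∀ k, k ≠ j → (y₁ k ⟶ w k)) (γ : y₀ j ⊗ y₁ j ⟶ w j)
    (q₀₀ : ∀ k, k ≠ i → (x₀₀ k ⟶ z₀ k)) (q₁₀ : ∀ k, k ≠ i → (x₁₀ k ⟶ z₀ k))
    (δ₀ : x₀₀ i ⊗ x₁₀ i ⟶ z₀ i)
    (q₀₁ : ∀ k, k ≠ i → (x₀₁ k ⟶ z₁ k)) (q₁₁ : ∀ k, k ≠ i → (x₁₁ k ⟶ z₁ k))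
    (δ₁ : x₀₁ i ⊗ x₁₁ i ⟶ z₁ i)
    (q₀ : ∀ k, k ≠ j → (z₀ k ⟶ w k)) (q₁ : ∀ k, k ≠ j → (z₁ k ⟶ w k)) (δ : z₀ j ⊗ z₁ j ⟶ w j)
    (e₀ : z₀ j ⟶ y₀ j) (e₁ : z₁ j ⟶ y₁ j)
    (h₀₀ : ∀ k (hi : k ≠ i) (hj : k ≠ j), p₀₀ k hi ≫ p₀ k hj = q₀₀ k hi ≫ q₀ k hj)
    (h₁₀ : ∀ k (hi : k ≠ i) (hj : k ≠ j), p₁₀ k hi ≫ p₀ k hj = q₁₀ k hi ≫ q₀ k hj)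
    (h₀₁ : ∀ k (hi : k ≠ i) (hj : k ≠ j), p₀₁ k hi ≫ p₁ k hj = q₀₁ k hi ≫ q₁ k hj)
    (h₁₁ : ∀ k (hi : k ≠ i) (hj : k ≠ j), p₁₁ k hi ≫ p₁ k hj = q₁₁ k hi ≫ q₁ k hj)
    (g₀ : γ₀ ≫ p₀ i hij = δ₀ ≫ q₀ i hij) (g₁ : γ₁ ≫ p₁ i hij = δ₁ ≫ q₁ i hij)
    (l₀₀ : p₀₀ j hij.symm = q₀₀ j hij.symm ≫ e₀) (l₁₀ : p₁₀ j hij.symm = q₁₀ j hij.symm ≫ e₀)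
    (l₀₁ : p₀₁ j hij.symm = q₀₁ j hij.symm ≫ e₁) (l₁₁ : p₁₁ j hij.symm = q₁₁ j hij.symm ≫ e₁)
    (hδ : δ = (e₀ ⊗ₘ e₁) ≫ γ) :
    (addHom Φ i p₀₀ p₁₀ γ₀ ⊗ₘ addHom Φ i p₀₁ p₁₁ γ₁) ≫ addHom Φ j p₀ p₁ γ =
      (addHom Φ i q₀₀ q₁₀ δ₀ ⊗ₘ addHom Φ i q₀₁ q₁₁ δ₁) ≫ addHom Φ j q₀ q₁ δ := by
  -- both sides factor through `Φ` of the families `w` with `y₀ j`, `y₁ j` as `j`-th coordinate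
  let m (y : ∀ k, E k) : ∀ k, E k := upd j w (y j)
  let s (y : ∀ k, E k) (p : ∀ k, k ≠ j → (y k ⟶ w k)) : y ⟶ m y :=
    glue j (fun k hk => p k hk ≫ eqToHom (insAt_obj_ne j (others j w) _ k hk).symm)
      (eqToHom (insAt_obj_self j _ _).symm)
  let t (y z : ∀ k, E k) (q : ∀ k, k ≠ j → (z k ⟶ w k)) (e : z j ⟶ y j) : z ⟶ m y :=
    glue j (fun k hk => q k hk ≫ eqToHom (insAt_obj_ne j (others j w) _ k hk).symm)
      (e ≫ eqToHom (insAt_obj_self j _ _).symm)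
  let n : m y₀ j ⊗ m y₁ j ⟶ w j :=
    (eqToHom (insAt_obj_self j _ _) ⊗ₘ eqToHom (insAt_obj_self j _ _)) ≫ γ
  have e1 : addHom Φ j p₀ p₁ γ = (Φ.map (s y₀ p₀) ⊗ₘ Φ.map (s y₁ p₁)) ≫
      addHom Φ j (u := m y₀) (v := m y₁) (w := w)
        (fun k hk => eqToHom (insAt_obj_ne j (others j w) _ k hk))
        (fun k hk => eqToHom (insAt_obj_ne j (others j w) _ k hk)) n := by
    have := hΦ.map_addHom_map j (s y₀ p₀) (s y₁ p₁) (𝟙 w)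
        (fun k hk => eqToHom (insAt_obj_ne j (others j w) _ k hk))
        (fun k hk => eqToHom (insAt_obj_ne j (others j w) _ k hk)) n
    rw [Φ.map_id, Category.comp_id] at this
    rw [this]
    congr 1
    · funext k hk
      simp [s, hk]
    · funext k hk
      simp [s, hk]
    · simp [s, n, tensorHom_comp_tensorHom_assoc]
  have e2 : addHom Φ j q₀ q₁ δ = (Φ.map (t y₀ z₀ q₀ e₀) ⊗ₘ Φ.map (t y₁ z₁ q₁ e₁)) ≫
      addHom Φ j (u := m y₀) (v := m y₁) (w := w)
        (fun k hk => eqToHom (insAt_obj_ne j (others j w) _ k hk))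
        (fun k hk => eqToHom (insAt_obj_ne j (others j w) _ k hk)) n := by
    have := hΦ.map_addHom_map j (t y₀ z₀ q₀ e₀) (t y₁ z₁ q₁ e₁) (𝟙 w)
        (fun k hk => eqToHom (insAt_obj_ne j (others j w) _ k hk))
        (fun k hk => eqToHom (insAt_obj_ne j (others j w) _ k hk)) n
    rw [Φ.map_id, Category.comp_id] at this
    rw [this, hδ]
    congr 1
    · funext k hk
      simp [t, hk]
    · funext k hk
      simp [t, hk]
    · simp [t, n, tensorHom_comp_tensorHom_assoc]
  -- Two additions in `i` with different targets agree after mapping to a common family `m` once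
  -- their components do. It is applied with the two routes into `m y₀`, and then into `m y₁`.
  have aux {x x' y z m : ∀ k, E k} (p : ∀ k, k ≠ i → (x k ⟶ y k)) (p' : ∀ k, k ≠ i → (x' k ⟶ y k))
      (γ : x i ⊗ x' i ⟶ y i) (q : ∀ k, k ≠ i → (x k ⟶ z k)) (q' : ∀ k, k ≠ i → (x' k ⟶ z k))
      (δ : x i ⊗ x' i ⟶ z i) (s : y ⟶ m) (t : z ⟶ m) (h : ∀ k hk, p k hk ≫ s k = q k hk ≫ t k)
      (h' : ∀ k hk, p' k hk ≫ s k = q' k hk ≫ t k) (g : γ ≫ s i = δ ≫ t i) :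
      addHom Φ i p p' γ ≫ Φ.map s = addHom Φ i q q' δ ≫ Φ.map t := by
    have h1 := hΦ.map_addHom_map i (𝟙 x) (𝟙 x') s p p' γ
    have h2 := hΦ.map_addHom_map i (𝟙 x) (𝟙 x') t q q' δ
    simp only [Φ.map_id, id_tensorHom_id, Category.id_comp, Pi.id_apply] at h1 h2
    rw [h1, h2]
    congr 1
    · funext k hk
      exact h k hk
    · funext k hk
      exact h' k hk
  rw [e1, e2, tensorHom_comp_tensorHom_assoc, tensorHom_comp_tensorHom_assoc]
  congr 2
  · apply aux
    · intro k hk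
      by_cases hj : k = j
      · subst hj
        simp [s, t, l₀₀]
      · simp [s, t, hj, reassoc_of% h₀₀ k hk hj]
    · intro k hk
      by_cases hj : k = j
      · subst hj
        simp [s, t, l₁₀]
      · simp [s, t, hj, reassoc_of% h₁₀ k hk hj]
    · simp [s, t, hij, reassoc_of% g₀]
  · apply aux
    · intro k hk
      by_cases hj : k = j
      · subst hj
        simp [s, t, l₀₁]
      · simp [s, t, hj, reassoc_of% h₀₁ k hk hj]
    · intro k hk
      by_cases hj : k = j
      · subst hj
        simp [s, t, l₁₁]
      · simp [s, t, hj, reassoc_of% h₁₁ k hk hj]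
    · simp [s, t, hij, reassoc_of% g₁]

end Interchange

/-! ### Equivalence of the substitution form and the `addHom` form of interchange and units. -/

section InterchangeComparison

variable {ι : Type w} {E : ι → Type u'} [∀ i, Category.{v'} (E i)] [∀ i, MonoidalCategory (E i)]
  {A : Type u'} [Category.{v'} A] [MonoidalCategory A] {Φ : (∀ i, E i) ⥤ A}
  [∀ i x, (insAt i x ⋙ Φ).LaxMonoidal]

open Functor.LaxMonoidal (μ μ_natural)

/-- Normal form for either side of the interchange identity: two applications of `map_μ_map`, the
connecting maps `s₀`, `s₁` being absorbed into the first layer. -/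
theorem IsNaturalInOthers.map_μ_map_μ_map (hΦ : IsNaturalInOthers Φ) {i j : ι}
    {x₀ x₁ : ∀ k : {k // k ≠ i}, E k} {y : ∀ k : {k // k ≠ j}, E k} {a₀ a₀' a₁ a₁' : E i}
    {b b' : E j} {x₀₀ x₁₀ x₀₁ x₁₁ w : ∀ k, E k}
    (f₀₀ : x₀₀ ⟶ (insAt i x₀).obj a₀) (f₁₀ : x₁₀ ⟶ (insAt i x₀).obj a₀')
    (f₀₁ : x₀₁ ⟶ (insAt i x₁).obj a₁) (f₁₁ : x₁₁ ⟶ (insAt i x₁).obj a₁')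
    (s₀ : (insAt i x₀).obj (a₀ ⊗ a₀') ⟶ (insAt j y).obj b)
    (s₁ : (insAt i x₁).obj (a₁ ⊗ a₁') ⟶ (insAt j y).obj b')
    (h : (insAt j y).obj (b ⊗ b') ⟶ w) :
    ((Φ.map f₀₀ ⊗ₘ Φ.map f₁₀) ⊗ₘ (Φ.map f₀₁ ⊗ₘ Φ.map f₁₁)) ≫
      (μ (insAt i x₀ ⋙ Φ) a₀ a₀' ⊗ₘ μ (insAt i x₁ ⋙ Φ) a₁ a₁') ≫
      (Φ.map s₀ ⊗ₘ Φ.map s₁) ≫ μ (insAt j y ⋙ Φ) b b' ≫ Φ.map h =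
    (addHom Φ i
        (fun k hk => f₀₀ k ≫ eqToHom ((insAt_obj_ne i x₀ _ k hk).trans
          (insAt_obj_ne i x₀ _ k hk).symm) ≫ s₀ k)
        (fun k hk => f₁₀ k ≫ eqToHom ((insAt_obj_ne i x₀ _ k hk).trans
          (insAt_obj_ne i x₀ _ k hk).symm) ≫ s₀ k)
        (((f₀₀ i ≫ eqToHom (insAt_obj_self i x₀ a₀)) ⊗ₘ
          (f₁₀ i ≫ eqToHom (insAt_obj_self i x₀ a₀'))) ≫
          eqToHom (insAt_obj_self i x₀ _).symm ≫ s₀ i) ⊗ₘ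
      addHom Φ i
        (fun k hk => f₀₁ k ≫ eqToHom ((insAt_obj_ne i x₁ _ k hk).trans
          (insAt_obj_ne i x₁ _ k hk).symm) ≫ s₁ k)
        (fun k hk => f₁₁ k ≫ eqToHom ((insAt_obj_ne i x₁ _ k hk).trans
          (insAt_obj_ne i x₁ _ k hk).symm) ≫ s₁ k)
        (((f₀₁ i ≫ eqToHom (insAt_obj_self i x₁ a₁)) ⊗ₘ
          (f₁₁ i ≫ eqToHom (insAt_obj_self i x₁ a₁'))) ≫
          eqToHom (insAt_obj_self i x₁ _).symm ≫ s₁ i)) ≫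
      addHom Φ j
        (fun k hk => eqToHom ((insAt_obj_ne j y _ k hk).trans
          (insAt_obj_ne j y _ k hk).symm) ≫ h k)
        (fun k hk => eqToHom ((insAt_obj_ne j y _ k hk).trans
          (insAt_obj_ne j y _ k hk).symm) ≫ h k)
        ((eqToHom (insAt_obj_self j y b) ⊗ₘ eqToHom (insAt_obj_self j y b')) ≫
          eqToHom (insAt_obj_self j y _).symm ≫ h j) := by
  have h1 := hΦ.map_μ_map j (𝟙 ((insAt j y).obj b)) (𝟙 ((insAt j y).obj b')) h
  simp only [Φ.map_id, id_tensorHom_id, Category.id_comp, Pi.id_apply] at h1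
  rw [← hΦ.map_μ_map i f₀₀ f₁₀ s₀, ← hΦ.map_μ_map i f₀₁ f₁₁ s₁, ← h1]
  simp only [← tensorHom_comp_tensorHom, Category.assoc]

theorem IsNaturalInOthers.unitHom_eq (hΦ : IsNaturalInOthers Φ) {i j : ι} (hij : i ≠ j)
    (hU : ∀ z : ∀ k, E k, Functor.LaxMonoidal.ε (insAt i (others i (upd j z (𝟙_ _))) ⋙ Φ) ≫
      Φ.map (eqToHom (upd_comm hij z (𝟙_ _) (𝟙_ _))) =
        Functor.LaxMonoidal.ε (insAt j (others j (upd i z (𝟙_ _))) ⋙ Φ))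
    {w : ∀ k, E k} (γ : 𝟙_ (E i) ⟶ w i) (δ : 𝟙_ (E j) ⟶ w j) :
    unitHom Φ i γ = unitHom Φ j δ := by
  -- Has `γ` at `i`, `δ` at `j` and identifications elsewhere, so that composing the unit identity
  -- with `Φ.map h` produces the two sides by `ε_map`.
  let h : upd j (upd i w (𝟙_ _)) (𝟙_ _) ⟶ w :=
    glue j (fun k hk => eqToHom (insAt_obj_ne j (others j (upd i w (𝟙_ _))) _ k hk) ≫
        glue i (u := upd i w (𝟙_ _))
          (fun k hk => eqToHom (insAt_obj_ne i (others i w) _ k hk))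
          (eqToHom (insAt_obj_self i (others i w) _) ≫ γ) k)
      (eqToHom (insAt_obj_self j _ _) ≫ δ)
  have key := hU w =≫ Φ.map h
  rw [Category.assoc, ← Φ.map_comp, hΦ.ε_map, hΦ.ε_map] at key
  simpa [h, hij] using key

theorem IsNaturalInOthers.ε_eq (hΦ : IsNaturalInOthers Φ) {i j : ι} (hij : i ≠ j)
    (hU : ∀ (w : ∀ k, E k) (γ : 𝟙_ (E i) ⟶ w i) (δ : 𝟙_ (E j) ⟶ w j),
      unitHom Φ i γ = unitHom Φ j δ) (z : ∀ k, E k) :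
    Functor.LaxMonoidal.ε (insAt i (others i (upd j z (𝟙_ _))) ⋙ Φ) ≫
      Φ.map (eqToHom (upd_comm hij z (𝟙_ _) (𝟙_ _))) =
        Functor.LaxMonoidal.ε (insAt j (others j (upd i z (𝟙_ _))) ⋙ Φ) := by
  have r := hΦ.ε_map j (𝟙 (upd j (upd i z (𝟙_ _)) (𝟙_ _)))
  rw [Φ.map_id] at r
  erw [Category.comp_id] at r
  rw [hΦ.ε_map, r]
  exact hU _ _ _

variable [BraidedCategory A]

/-- The general square is obtained from the one for substitutions into `w` by mapping the four
corners into it and mapping its end to `w`. The component hypotheses say that these maps reproduce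
the given additions. -/
theorem InsInterchange.addInterchange (hΦ : IsNaturalInOthers Φ) {i j : ι} (hij : i ≠ j)
    (hI : InsInterchange Φ i j hij) : AddInterchange Φ i j := by
  intro x₀₀ x₁₀ x₀₁ x₁₁ y₀ y₁ z₀ z₁ w p₀₀ p₁₀ γ₀ p₀₁ p₁₁ γ₁ p₀ p₁ γ q₀₀ q₀₁ δ₀ q₁₀ q₁₁ δ₁ q₀ q₁ δ
    _ h₀₀ h₁₀ h₀₁ h₁₁ hγ₀ hγ₁ hδ₀ hδ₁
  let s (y : ∀ k, E k) (p : ∀ k, k ≠ j → (y k ⟶ w k)) : y ⟶ upd j w (y j) :=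
    glue j (fun k hk => p k hk ≫ eqToHom (insAt_obj_ne j (others j w) _ k hk).symm)
      (eqToHom (insAt_obj_self j _ _).symm)
  let f {x y z : ∀ k, E k} (p : ∀ k, k ≠ i → (x k ⟶ y k)) (p' : ∀ k, k ≠ j → (y k ⟶ w k))
      (q : ∀ k, k ≠ j → (x k ⟶ z k)) : x ⟶ upd i (upd j w (y j)) (z i) :=
    glue i (fun k hk => p k hk ≫ s y p' k ≫
        eqToHom (insAt_obj_ne i (others i (upd j w (y j))) _ k hk).symm)
      (q i hij ≫ eqToHom (insAt_obj_self i _ _).symm)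
  -- The last additions `δ` in coordinate `i` and `γ` in coordinate `j`, performed at once.
  let h : upd j (upd i w (z₀ i ⊗ z₁ i)) (y₀ j ⊗ y₁ j) ⟶ w :=
    glue j (fun k hk => eqToHom (insAt_obj_ne j (others j (upd i w (z₀ i ⊗ z₁ i))) _ k hk) ≫
        glue i (u := upd i w (z₀ i ⊗ z₁ i))
          (fun k hk => eqToHom (insAt_obj_ne i (others i w) _ k hk))
          (eqToHom (insAt_obj_self i (others i w) _) ≫ δ) k)
      (eqToHom (insAt_obj_self j _ _) ≫ γ)
  -- The `i`-coordinates come from the route that adds in `j` first, hence are untouched by it up to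
  -- `q`; the `j`-coordinates come from the other route.
  have key := hI w (z₀ i) (z₁ i) (y₀ j) (y₁ j)
  replace key := ((Φ.map (f p₀₀ p₀ q₀₀) ⊗ₘ Φ.map (f p₁₀ p₀ q₁₀)) ⊗ₘ
    (Φ.map (f p₀₁ p₁ q₀₁) ⊗ₘ Φ.map (f p₁₁ p₁ q₁₁))) ≫= key =≫ Φ.map h
  simp only [Category.assoc] at key
  rw [hΦ.map_μ_map_μ_map, tensorμ_natural_assoc,
    tensorHom_comp_tensorHom_assoc (Φ.map _ ⊗ₘ Φ.map _), tensorHom_comp_tensorHom (Φ.map _),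
    tensorHom_comp_tensorHom (Φ.map _)] at key
  simp only [← Φ.map_comp] at key
  rw [hΦ.map_μ_map_μ_map] at key
  -- The normal forms of `key` have substituted families in the middle instead of `y₀`, `y₁` and
  -- `z₀`, `z₁`; the relevant coordinates agree, so the comparisons `e₀`, `e₁` are identifications.
  refine (hΦ.addHom_comp_congr hij _ _ _ _ _ _ _ _ _ _ _ _ _ _ _ _ _ _
    (eqToHom (insAt_obj_self j _ _)) (eqToHom (insAt_obj_self j _ _))
    ?_ ?_ ?_ ?_ ?_ ?_ ?_ ?_ ?_ ?_ ?_).trans (key.trans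
    (congrArg (tensorμ _ _ _ _ ≫ ·) (hΦ.addHom_comp_congr hij.symm
      _ _ _ _ _ _ _ _ _ _ _ _ _ _ _ _ _ _
      (eqToHom (insAt_obj_self i _ _)) (eqToHom (insAt_obj_self i _ _))
      ?_ ?_ ?_ ?_ ?_ ?_ ?_ ?_ ?_ ?_ ?_).symm))
  all_goals try intro k hk hk'
  all_goals simp [f, s, h, tensorHom_eqToHom, hij.symm, *]

theorem AddInterchange.insInterchange (hΦ : IsNaturalInOthers Φ) {i j : ι} (hij : i ≠ j)
    (hI : AddInterchange Φ i j) : InsInterchange Φ i j hij := by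
  intro z a a' b b'
  have l := hΦ.map_μ_map_μ_map (𝟙 (upd i (upd j z b) a)) (𝟙 (upd i (upd j z b) a'))
    (𝟙 (upd i (upd j z b') a)) (𝟙 (upd i (upd j z b') a'))
    (eqToHom (upd_comm hij z (a ⊗ a') b)) (eqToHom (upd_comm hij z (a ⊗ a') b'))
    (𝟙 (upd j (upd i z (a ⊗ a')) (b ⊗ b')))
  have r := hΦ.map_μ_map_μ_map (eqToHom (upd_comm hij z a b)) (eqToHom (upd_comm hij z a b'))
    (eqToHom (upd_comm hij z a' b)) (eqToHom (upd_comm hij z a' b'))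
    (eqToHom (upd_comm hij z a (b ⊗ b')).symm) (eqToHom (upd_comm hij z a' (b ⊗ b')).symm)
    (eqToHom (upd_comm hij z (a ⊗ a') (b ⊗ b')))
  simp only [Φ.map_id, id_tensorHom_id, Category.id_comp] at l
  erw [Category.comp_id] at l
  rw [l, r]
  apply hI _ _ _ _ _ _ _ _ _ _ _ _ _ _ _ _ _ _ hij
  all_goals try intro k hk hk'
  all_goals simp [tensorHom_eqToHom]

end InterchangeComparison

/-! ### Substitution of functors of several variables -/

section Block

variable {ι : Type w} {κ : ι → Type w'} {E' : (i : ι) → κ i → Type u'}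
  [∀ i a, Category.{v'} (E' i a)]

local notation "𝓔" => fun r : (i : ι) × κ i => E' (Sigma.fst r) (Sigma.snd r)

/-- The coordinates other than `q.2` of the block of `q`. -/
abbrev blockOthers (q : (i : ι) × κ i) (x : ∀ r : {r // r ≠ q}, E' r.1.1 r.1.2) :
    ∀ b : {b // b ≠ q.2}, E' q.1 b :=
  fun b => x ⟨⟨q.1, b⟩, fun h => b.2 (eq_of_heq (Sigma.mk.inj h).2)⟩

theorem block_insAt (q : (i : ι) × κ i) (x : ∀ r : {r // r ≠ q}, E' r.1.1 r.1.2) (z : E' q.1 q.2) :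
    (block q.1).obj ((insAt (E := 𝓔) q x).obj z) =
      (insAt q.2 (blockOthers q x)).obj z := by
  funext b
  change (insAt (E := 𝓔) q x).obj z ⟨q.1, b⟩ = _
  by_cases hb : b = q.2
  · subst hb
    exact (insAt_obj_self (E := 𝓔) q x z).trans
      (insAt_obj_self q.2 _ z).symm
  · exact (insAt_obj_ne (E := 𝓔) q x z ⟨q.1, b⟩
      fun h => hb (eq_of_heq (Sigma.mk.inj h).2)).trans
        (insAt_obj_ne q.2 (blockOthers q x) z b hb).symm

theorem block_insAt_ne (q : (i : ι) × κ i) (x : ∀ r : {r // r ≠ q}, E' r.1.1 r.1.2)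
    (z z' : E' q.1 q.2) (j : ι) (hj : j ≠ q.1) :
    (block j).obj ((insAt (E := 𝓔) q x).obj z) =
      (block j).obj ((insAt (E := 𝓔) q x).obj z') := by
  funext b
  have hne : (⟨j, b⟩ : (i : ι) × κ i) ≠ q := fun h => hj (congrArg Sigma.fst h)
  exact (insAt_obj_ne (E := 𝓔) q x z _ hne).trans
    (insAt_obj_ne (E := 𝓔) q x z' _ hne).symm

end Block

/-! ### Structure morphisms of a composite functor. -/

section Blocks

variable {ι : Type w} {κ : ι → Type w'}
  {E : ι → Type u'} [∀ i, Category.{v'} (E i)] [∀ i, MonoidalCategory (E i)]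
  {E' : (i : ι) → κ i → Type u'} [∀ i a, Category.{v'} (E' i a)]
  [∀ i a, MonoidalCategory (E' i a)]
  {A : Type u'} [Category.{v'} A] [MonoidalCategory A]
  (R : ∀ i, (∀ a, E' i a) ⥤ E i) (Φ : (∀ i, E i) ⥤ A)
  [∀ i a x, (insAt a x ⋙ R i).Monoidal] [∀ i x, (insAt i x ⋙ Φ).Monoidal]

open Functor.LaxMonoidal (μ μ_natural)

local notation "𝓔" => fun r : (i : ι) × κ i => E' (Sigma.fst r) (Sigma.snd r)

/-- The monoidal structure of `Φ(R₁, …, Rₙ)` as a functor of the variable `q`. -/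
@[reducible]
def blocksMonoidal (q : (i : ι) × κ i) (x : ∀ r : {r // r ≠ q}, E' r.1.1 r.1.2) :
    (insAt (E := 𝓔) q x ⋙ blocks R ⋙ Φ).Monoidal :=
  Functor.Monoidal.transport (F := (insAt q.2 _ ⋙ R q.1) ⋙ (insAt q.1 _ ⋙ Φ))
    (Functor.isoWhiskerRight (eqToIso (insAt_comp_blocks R q x).symm) Φ)

attribute [local instance] blocksMonoidal

/-- The value of `addHom` for `Φ(R₁, …, Rₙ)` and the variable `q`, in terms of `Φ` and the `R i`. -/
def blocksAddHom (q : (i : ι) × κ i) {u v w : ∀ r : (i : ι) × κ i, E' r.1 r.2}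
    (α : ∀ r, r ≠ q → (u r ⟶ w r)) (β : ∀ r, r ≠ q → (v r ⟶ w r)) (γ : u q ⊗ v q ⟶ w q) :
    (blocks R ⋙ Φ).obj u ⊗ (blocks R ⋙ Φ).obj v ⟶ (blocks R ⋙ Φ).obj w :=
  addHom Φ q.1 (u := (blocks R).obj u) (v := (blocks R).obj v) (w := (blocks R).obj w)
    (fun j hj => (R j).map fun b => α ⟨j, b⟩ fun h => hj (congrArg Sigma.fst h))
    (fun j hj => (R j).map fun b => β ⟨j, b⟩ fun h => hj (congrArg Sigma.fst h))
    (addHom (R q.1) q.2 (u := (block q.1).obj u) (v := (block q.1).obj v) (w := (block q.1).obj w)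
      (fun b hb => α ⟨q.1, b⟩ fun h => hb (eq_of_heq (Sigma.mk.inj h).2))
      (fun b hb => β ⟨q.1, b⟩ fun h => hb (eq_of_heq (Sigma.mk.inj h).2)) γ)

variable {R Φ}

/-- The transported structure is that of a composite of two monoidal functors, conjugated by
identifications of families; `map_μ_map` for `Φ` then absorbs these identifications. -/
theorem blocks_μ (hΦ : IsNaturalInOthers Φ) (q : (i : ι) × κ i)
    (x : ∀ r : {r // r ≠ q}, E' r.1.1 r.1.2) (a a' : E' q.1 q.2) :
    μ (insAt (E := 𝓔) q x ⋙ blocks R ⋙ Φ) a a' =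
      addHom Φ q.1
        (u := (blocks R).obj ((insAt (E := 𝓔) q x).obj a))
        (v := (blocks R).obj ((insAt (E := 𝓔) q x).obj a'))
        (w := (blocks R).obj ((insAt (E := 𝓔) q x).obj (a ⊗ a')))
        (fun j hj => (R j).map (eqToHom (block_insAt_ne q x _ _ j hj)))
        (fun j hj => (R j).map (eqToHom (block_insAt_ne q x _ _ j hj)))
        (((R q.1).map (eqToHom (block_insAt q x a)) ⊗ₘ (R q.1).map (eqToHom (block_insAt q x a'))) ≫
          μ (insAt q.2 (blockOthers q x) ⋙ R q.1) a a' ≫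
            (R q.1).map (eqToHom (block_insAt q x (a ⊗ a')).symm)) := by
  let y : ∀ j : {j // j ≠ q.1}, E j := fun j => (R j).obj fun b =>
    x ⟨⟨j, b⟩, fun h => j.2 (congrArg Sigma.fst h)⟩
  have eo (z : E' q.1 q.2) := Functor.congr_obj (insAt_comp_blocks R q x) z
  refine (Functor.Monoidal.transport_μ
    (F := (insAt q.2 (blockOthers q x) ⋙ R q.1) ⋙ (insAt q.1 y ⋙ Φ))
    (Functor.isoWhiskerRight (eqToIso (insAt_comp_blocks R q x).symm) Φ) a a').trans ?_
  refine Eq.trans ?_ ((hΦ.map_μ_map q.1 (eqToHom (eo a)) (eqToHom (eo a'))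
    ((insAt q.1 y).map (μ (insAt q.2 (blockOthers q x) ⋙ R q.1) a a') ≫
      eqToHom (eo (a ⊗ a')).symm)).trans ?_)
  · simp [eqToHom_app]
    rfl
  · congr 1
    · funext j hj
      simp [insAt_map_ne _ _ _ _ hj, eqToHom_map]
      rfl
    · funext j hj
      simp [insAt_map_ne _ _ _ _ hj, eqToHom_map]
      rfl
    · simp [insAt_map_self, eqToHom_map]
      rfl

theorem blocks_ε (hΦ : IsNaturalInOthers Φ) (q : (i : ι) × κ i)
    (x : ∀ r : {r // r ≠ q}, E' r.1.1 r.1.2) :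
    Functor.LaxMonoidal.ε (insAt (E := 𝓔) q x ⋙ blocks R ⋙ Φ) =
      unitHom Φ q.1
        (w := (blocks R).obj ((insAt (E := 𝓔) q x).obj
          (𝟙_ (E' q.1 q.2))))
        (Functor.LaxMonoidal.ε (insAt q.2 (blockOthers q x) ⋙ R q.1) ≫
            (R q.1).map (eqToHom (block_insAt q x _).symm)) := by
  let y : ∀ j : {j // j ≠ q.1}, E j := fun j => (R j).obj fun b =>
    x ⟨⟨j, b⟩, fun h => j.2 (congrArg Sigma.fst h)⟩
  have eo (z : E' q.1 q.2) := Functor.congr_obj (insAt_comp_blocks R q x) z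
  refine (Functor.Monoidal.transport_ε
    (F := (insAt q.2 (blockOthers q x) ⋙ R q.1) ⋙ (insAt q.1 y ⋙ Φ))
    (Functor.isoWhiskerRight (eqToIso (insAt_comp_blocks R q x).symm) Φ)).trans ?_
  refine Eq.trans ?_ ((hΦ.ε_map q.1
    ((insAt q.1 y).map (Functor.LaxMonoidal.ε (insAt q.2 (blockOthers q x) ⋙ R q.1)) ≫
      eqToHom (eo (𝟙_ _)).symm)).trans ?_)
  · simp [eqToHom_app]
  · congr 1
    simp [insAt_map_self, eqToHom_map]
    rfl

/-- Only the outer functor is put in normal form, the structure morphism of `R q.1` being left as it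
is. This half-expanded form relies on naturality of `Φ` alone, and it serves in the proof of
associativity, where the inner functors are themselves composites. -/
theorem map_blocks_μ_map (hΦ : IsNaturalInOthers Φ) (q : (i : ι) × κ i)
    {x : ∀ r : {r // r ≠ q}, E' r.1.1 r.1.2} {a a' : E' q.1 q.2}
    {u v w : ∀ r : (i : ι) × κ i, E' r.1 r.2}
    (f : u ⟶ (insAt (E := 𝓔) q x).obj a)
    (g : v ⟶ (insAt (E := 𝓔) q x).obj a')
    (h : (insAt (E := 𝓔) q x).obj (a ⊗ a') ⟶ w) :
    ((blocks R ⋙ Φ).map f ⊗ₘ (blocks R ⋙ Φ).map g) ≫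
      μ (insAt (E := 𝓔) q x ⋙ blocks R ⋙ Φ) a a' ≫
        (blocks R ⋙ Φ).map h =
    addHom Φ q.1 (u := (blocks R).obj u) (v := (blocks R).obj v) (w := (blocks R).obj w)
      (fun j hj => (R j).map ((block j).map f ≫ eqToHom (block_insAt_ne q x _ _ j hj) ≫
        (block j).map h))
      (fun j hj => (R j).map ((block j).map g ≫ eqToHom (block_insAt_ne q x _ _ j hj) ≫
        (block j).map h))
      (((R q.1).map ((block q.1).map f ≫ eqToHom (block_insAt q x a)) ⊗ₘ
          (R q.1).map ((block q.1).map g ≫ eqToHom (block_insAt q x a'))) ≫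
        μ (insAt q.2 (blockOthers q x) ⋙ R q.1) a a' ≫
          (R q.1).map (eqToHom (block_insAt q x (a ⊗ a')).symm ≫ (block q.1).map h)) := by
  rw [blocks_μ hΦ]
  refine (hΦ.map_addHom_map q.1 ((blocks R).map f) ((blocks R).map g) ((blocks R).map h)
    _ _ _).trans ?_
  simp only [Functor.map_comp]
  refine congrArg (addHom Φ q.1 _ _) ?_
  refine Eq.trans ?_ (congrArg (· ≫ _) (tensorHom_comp_tensorHom _ _ _ _))
  refine Eq.trans (congrArg (_ ≫ ·) ?_) (Category.assoc _ _ _).symm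
  exact (Category.assoc _ _ _).trans (congrArg (_ ≫ ·) (Category.assoc _ _ _))

theorem ε_blocks_map (hΦ : IsNaturalInOthers Φ) (q : (i : ι) × κ i)
    {x : ∀ r : {r // r ≠ q}, E' r.1.1 r.1.2} {w : ∀ r : (i : ι) × κ i, E' r.1 r.2}
    (h : (insAt (E := 𝓔) q x).obj (𝟙_ (E' q.1 q.2)) ⟶ w) :
    Functor.LaxMonoidal.ε
        (insAt (E := 𝓔) q x ⋙ blocks R ⋙ Φ) ≫
          (blocks R ⋙ Φ).map h =
      unitHom Φ q.1 (w := (blocks R).obj w)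
        (Functor.LaxMonoidal.ε (insAt q.2 (blockOthers q x) ⋙ R q.1) ≫
          (R q.1).map (eqToHom (block_insAt q x _).symm ≫ (block q.1).map h)) := by
  rw [blocks_ε hΦ]
  refine (hΦ.unitHom_map q.1 ((blocks R).map h) _).trans ?_
  rw [Functor.map_comp]
  exact congrArg (unitHom Φ q.1) (Category.assoc _ _ _)

theorem blocks_map_μ_map (hΦ : IsNaturalInOthers Φ) (hR : ∀ i, IsNaturalInOthers (R i))
    (q : (i : ι) × κ i) {x : ∀ r : {r // r ≠ q}, E' r.1.1 r.1.2}
    {a a' : E' q.1 q.2} {u v w : ∀ r : (i : ι) × κ i, E' r.1 r.2}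
    (f : u ⟶ (insAt (E := 𝓔) q x).obj a)
    (g : v ⟶ (insAt (E := 𝓔) q x).obj a')
    (h : (insAt (E := 𝓔) q x).obj (a ⊗ a') ⟶ w) :
    ((blocks R ⋙ Φ).map f ⊗ₘ (blocks R ⋙ Φ).map g) ≫
      μ (insAt (E := 𝓔) q x ⋙ blocks R ⋙ Φ) a a' ≫
        (blocks R ⋙ Φ).map h =
    blocksAddHom R Φ q
      (fun r hr => f r ≫ eqToHom ((insAt_obj_ne (E := 𝓔) q x _ r hr).trans
        (insAt_obj_ne (E := 𝓔) q x _ r hr).symm) ≫ h r)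
      (fun r hr => g r ≫ eqToHom ((insAt_obj_ne (E := 𝓔) q x _ r hr).trans
        (insAt_obj_ne (E := 𝓔) q x _ r hr).symm) ≫ h r)
      (((f q ≫ eqToHom (insAt_obj_self (E := 𝓔) q x a)) ⊗ₘ
        (g q ≫ eqToHom (insAt_obj_self (E := 𝓔) q x a'))) ≫
        eqToHom (insAt_obj_self (E := 𝓔) q x (a ⊗ a')).symm ≫
          h q) := by
  refine (map_blocks_μ_map hΦ q f g h).trans ?_
  unfold blocksAddHom
  congr 1
  · funext j hj
    refine congrArg (R j).map (funext fun b => ?_)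
    simp
    rfl
  · funext j hj
    refine congrArg (R j).map (funext fun b => ?_)
    simp
    rfl
  · refine ((hR q.1).map_μ_map q.2 _ _ _).trans ?_
    congr 1
    · funext b hb
      simp
      rfl
    · funext b hb
      simp
      rfl
    · simp
      rfl

theorem blocks_ε_map (hΦ : IsNaturalInOthers Φ) (hR : ∀ i, IsNaturalInOthers (R i))
    (q : (i : ι) × κ i) {x : ∀ r : {r // r ≠ q}, E' r.1.1 r.1.2}
    {w : ∀ r : (i : ι) × κ i, E' r.1 r.2}
    (h : (insAt (E := 𝓔) q x).obj (𝟙_ (E' q.1 q.2)) ⟶ w) :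
    Functor.LaxMonoidal.ε (insAt (E := 𝓔) q x ⋙ blocks R ⋙ Φ) ≫ (blocks R ⋙ Φ).map h =
      unitHom Φ q.1 (w := (blocks R).obj w) (unitHom (R q.1) q.2 (w := (block q.1).obj w)
        (eqToHom (insAt_obj_self (E := 𝓔) q x (𝟙_ (E' q.1 q.2))).symm ≫ h q)) := by
  refine (ε_blocks_map hΦ q h).trans ?_
  congr 1
  refine ((hR q.1).ε_map q.2 _).trans ?_
  congr 1
  simp
  rfl

/-- Both sides of each monoidality identity have normal forms with equal components: in coordinates
other than `q` both are `φ`, in coordinate `q` both are identifications. -/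
theorem blocks_isNaturalInOthers (hΦ : IsNaturalInOthers Φ) (hR : ∀ i, IsNaturalInOthers (R i)) :
    IsNaturalInOthers (E := 𝓔) (blocks R ⋙ Φ) := by
  intro q x y φ
  refine ⟨?_, fun a a' => ?_⟩
  · have l := blocks_ε_map hΦ hR q ((insAtMap (E := 𝓔) q φ).app (𝟙_ (E' q.1 q.2)))
    have r := blocks_ε_map hΦ hR q (𝟙 ((insAt (E := 𝓔) q y).obj (𝟙_ (E' q.1 q.2))))
    rw [CategoryTheory.Functor.map_id] at r
    erw [Category.comp_id] at r
    refine l.trans (Eq.trans ?_ r.symm)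
    congr 2
    rw [insAtMap_app_self, Pi.id_apply]
    erw [eqToHom_trans, Category.comp_id]
    rfl
  · have l := blocks_map_μ_map hΦ hR q (𝟙 ((insAt (E := 𝓔) q x).obj a))
      (𝟙 ((insAt (E := 𝓔) q x).obj a'))
      ((insAtMap (E := 𝓔) q φ).app (a ⊗ a'))
    have r := blocks_map_μ_map hΦ hR q ((insAtMap (E := 𝓔) q φ).app a)
      ((insAtMap (E := 𝓔) q φ).app a')
      (𝟙 ((insAt (E := 𝓔) q y).obj (a ⊗ a')))
    rw [CategoryTheory.Functor.map_id] at r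
    erw [Category.comp_id] at r
    rw [CategoryTheory.Functor.map_id, CategoryTheory.Functor.map_id, id_tensorHom_id] at l
    erw [Category.id_comp] at l
    refine l.trans (Eq.trans ?_ r.symm)
    congr 1
    · funext k hk
      simp [insAtMap_app_ne _ _ _ _ hk]
    · funext k hk
      simp [insAtMap_app_ne _ _ _ _ hk]
    · simp [insAtMap_app_self, tensorHom_eqToHom]

/-- Reduces every later statement about the composite to one application of the corresponding
statement for `Φ` and one for `R q.1`. -/
theorem addHom_blocks (hΦ : IsNaturalInOthers Φ) (hR : ∀ i, IsNaturalInOthers (R i))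
    (q : (i : ι) × κ i) {u v w : ∀ r : (i : ι) × κ i, E' r.1 r.2}
    (α : ∀ r, r ≠ q → (u r ⟶ w r)) (β : ∀ r, r ≠ q → (v r ⟶ w r)) (γ : u q ⊗ v q ⟶ w q) :
    addHom (E := 𝓔) (blocks R ⋙ Φ) q α β γ = blocksAddHom R Φ q α β γ := by
  unfold addHom
  rw [blocks_map_μ_map hΦ hR]
  congr 1
  · funext k hk
    simp [hk]
  · funext k hk
    simp [hk]
  · simp

theorem unitHom_blocks (hΦ : IsNaturalInOthers Φ) (hR : ∀ i, IsNaturalInOthers (R i))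
    (q : (i : ι) × κ i) {w : ∀ r : (i : ι) × κ i, E' r.1 r.2} (γ : 𝟙_ (E' q.1 q.2) ⟶ w q) :
    unitHom (E := 𝓔) (blocks R ⋙ Φ) q γ = unitHom Φ q.1 (w := (blocks R).obj w)
      (unitHom (R q.1) q.2 (w := (block q.1).obj w) γ) := by
  conv_lhs => unfold unitHom
  rw [blocks_ε_map hΦ hR]
  congr 2
  rw [glue_self]
  erw [eqToHom_trans_assoc]
  exact Category.id_comp _

end Blocks

/-! ### Interchange of a variable with itself for a braided functor. -/

section DiagonalInterchange

variable {ι : Type w} {E : ι → Type u'} [∀ i, Category.{v'} (E i)] [∀ i, MonoidalCategory (E i)]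
  {A : Type u'} [Category.{v'} A] [MonoidalCategory A] {Φ : (∀ i, E i) ⥤ A}
  [∀ i x, (insAt i x ⋙ Φ).LaxMonoidal]

open Functor.LaxMonoidal (μ μ_natural)

theorem IsNaturalInOthers.addHom_map_glue (hΦ : IsNaturalInOthers Φ) (i : ι)
    {u v y w : ∀ k, E k} (α : ∀ k, k ≠ i → (u k ⟶ y k)) (β : ∀ k, k ≠ i → (v k ⟶ y k))
    (γ : u i ⊗ v i ⟶ y i) (ρ : ∀ k, k ≠ i → (y k ⟶ w k)) :
    addHom Φ i α β γ ≫ Φ.map (glue i (w := (insAt i (others i w)).obj (y i))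
      (fun k hk => ρ k hk ≫ eqToHom (insAt_obj_ne i (others i w) _ k hk).symm)
      (eqToHom (insAt_obj_self i _ _).symm)) =
    (Φ.map (glue i (w := (insAt i (others i w)).obj (u i))
        (fun k hk => (α k hk ≫ ρ k hk) ≫ eqToHom (insAt_obj_ne i (others i w) _ k hk).symm)
        (eqToHom (insAt_obj_self i _ _).symm)) ⊗ₘ
      Φ.map (glue i (w := (insAt i (others i w)).obj (v i))
        (fun k hk => (β k hk ≫ ρ k hk) ≫ eqToHom (insAt_obj_ne i (others i w) _ k hk).symm)
        (eqToHom (insAt_obj_self i _ _).symm))) ≫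
      μ (insAt i (others i w) ⋙ Φ) (u i) (v i) ≫ (insAt i (others i w) ⋙ Φ).map γ := by
  have l := hΦ.map_addHom_map i (𝟙 u) (𝟙 v) (glue i (w := (insAt i (others i w)).obj (y i))
      (fun k hk => ρ k hk ≫ eqToHom (insAt_obj_ne i (others i w) _ k hk).symm)
      (eqToHom (insAt_obj_self i _ _).symm)) α β γ
  simp only [Φ.map_id, id_tensorHom_id, Category.id_comp, Pi.id_apply] at l
  rw [l, Functor.comp_map, hΦ.map_μ_map]
  congr 1
  · funext k hk
    simp [hk, insAt_map_ne _ _ _ _ hk]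
  · funext k hk
    simp [hk, insAt_map_ne _ _ _ _ hk]
  · simp [insAt_map_self]

/-- Two successive additions in one variable are brought to the single monoidal functor with the
other coordinates fixed at those of `w`, all comparison morphisms being moved to the ends. -/
theorem IsNaturalInOthers.addHom_comp_addHom (hΦ : IsNaturalInOthers Φ) (i : ι)
    {x₀₀ x₁₀ x₀₁ x₁₁ y₀ y₁ w : ∀ k, E k}
    (p₀₀ : ∀ k, k ≠ i → (x₀₀ k ⟶ y₀ k)) (p₁₀ : ∀ k, k ≠ i → (x₁₀ k ⟶ y₀ k))
    (γ₀ : x₀₀ i ⊗ x₁₀ i ⟶ y₀ i)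
    (p₀₁ : ∀ k, k ≠ i → (x₀₁ k ⟶ y₁ k)) (p₁₁ : ∀ k, k ≠ i → (x₁₁ k ⟶ y₁ k))
    (γ₁ : x₀₁ i ⊗ x₁₁ i ⟶ y₁ i)
    (p₀ : ∀ k, k ≠ i → (y₀ k ⟶ w k)) (p₁ : ∀ k, k ≠ i → (y₁ k ⟶ w k))
    (γ : y₀ i ⊗ y₁ i ⟶ w i) :
    (addHom Φ i p₀₀ p₁₀ γ₀ ⊗ₘ addHom Φ i p₀₁ p₁₁ γ₁) ≫ addHom Φ i p₀ p₁ γ =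
    ((Φ.map (glue i (w := (insAt i (others i w)).obj (x₀₀ i))
        (fun k hk => (p₀₀ k hk ≫ p₀ k hk) ≫ eqToHom (insAt_obj_ne i (others i w) _ k hk).symm)
        (eqToHom (insAt_obj_self i _ _).symm)) ⊗ₘ
      Φ.map (glue i (w := (insAt i (others i w)).obj (x₁₀ i))
        (fun k hk => (p₁₀ k hk ≫ p₀ k hk) ≫ eqToHom (insAt_obj_ne i (others i w) _ k hk).symm)
        (eqToHom (insAt_obj_self i _ _).symm))) ⊗ₘ
      (Φ.map (glue i (w := (insAt i (others i w)).obj (x₀₁ i))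
        (fun k hk => (p₀₁ k hk ≫ p₁ k hk) ≫ eqToHom (insAt_obj_ne i (others i w) _ k hk).symm)
        (eqToHom (insAt_obj_self i _ _).symm)) ⊗ₘ
      Φ.map (glue i (w := (insAt i (others i w)).obj (x₁₁ i))
        (fun k hk => (p₁₁ k hk ≫ p₁ k hk) ≫ eqToHom (insAt_obj_ne i (others i w) _ k hk).symm)
        (eqToHom (insAt_obj_self i _ _).symm)))) ≫
      (μ (insAt i (others i w) ⋙ Φ) (x₀₀ i) (x₁₀ i) ⊗ₘ
        μ (insAt i (others i w) ⋙ Φ) (x₀₁ i) (x₁₁ i)) ≫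
      μ (insAt i (others i w) ⋙ Φ) (x₀₀ i ⊗ x₁₀ i) (x₀₁ i ⊗ x₁₁ i) ≫
      Φ.map (glue i (u := (insAt i (others i w)).obj ((x₀₀ i ⊗ x₁₀ i) ⊗ (x₀₁ i ⊗ x₁₁ i)))
        (fun k hk => eqToHom (insAt_obj_ne i _ _ k hk))
        (eqToHom (insAt_obj_self i _ _) ≫ (γ₀ ⊗ₘ γ₁) ≫ γ)) := by
  have hs : glue i (u := (insAt i (others i w)).obj ((x₀₀ i ⊗ x₁₀ i) ⊗ (x₀₁ i ⊗ x₁₁ i))) (w := w)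
        (fun k hk => eqToHom (insAt_obj_ne i _ _ k hk))
        (eqToHom (insAt_obj_self i _ _) ≫ (γ₀ ⊗ₘ γ₁) ≫ γ) =
      (insAt i (others i w)).map (γ₀ ⊗ₘ γ₁) ≫
      glue i (fun k hk => eqToHom (insAt_obj_ne i _ _ k hk))
        (eqToHom (insAt_obj_self i _ _) ≫ γ) := by
    apply hom_ext_at i
    · simp [insAt_map_self]
    · intro k hk
      simp [hk, insAt_map_ne _ _ _ _ hk]
  rw [hs, Φ.map_comp, ← reassoc_of% (μ_natural (insAt i (others i w) ⋙ Φ) γ₀ γ₁)]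
  conv_lhs => enter [2]; unfold addHom
  rw [tensorHom_comp_tensorHom_assoc, hΦ.addHom_map_glue, hΦ.addHom_map_glue]
  simp only [Functor.comp_map, ← tensorHom_comp_tensorHom, Category.assoc]

/-- A braided monoidal functor is compatible with the middle-four exchange `tensorμ`. Hence an
interchange identity `h` among the `i`-th coordinates is carried to one among the values of `Φ`. -/
theorem IsNaturalInOthers.addHom_interchange_self [∀ i, BraidedCategory (E i)] [BraidedCategory A]
    (hΦ : IsNaturalInOthers Φ) (i : ι)
    (hb : ∀ (x : ∀ j : {j // j ≠ i}, E j) (a a' : E i),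
      μ (insAt i x ⋙ Φ) a a' ≫ (insAt i x ⋙ Φ).map (β_ a a').hom =
        (β_ ((insAt i x ⋙ Φ).obj a) ((insAt i x ⋙ Φ).obj a')).hom ≫ μ (insAt i x ⋙ Φ) a' a)
    {x₀₀ x₁₀ x₀₁ x₁₁ y₀ y₁ z₀ z₁ w : ∀ k, E k}
    (p₀₀ : ∀ k, k ≠ i → (x₀₀ k ⟶ y₀ k)) (p₁₀ : ∀ k, k ≠ i → (x₁₀ k ⟶ y₀ k))
    (γ₀ : x₀₀ i ⊗ x₁₀ i ⟶ y₀ i)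
    (p₀₁ : ∀ k, k ≠ i → (x₀₁ k ⟶ y₁ k)) (p₁₁ : ∀ k, k ≠ i → (x₁₁ k ⟶ y₁ k))
    (γ₁ : x₀₁ i ⊗ x₁₁ i ⟶ y₁ i)
    (p₀ : ∀ k, k ≠ i → (y₀ k ⟶ w k)) (p₁ : ∀ k, k ≠ i → (y₁ k ⟶ w k)) (γ : y₀ i ⊗ y₁ i ⟶ w i)
    (q₀₀ : ∀ k, k ≠ i → (x₀₀ k ⟶ z₀ k)) (q₀₁ : ∀ k, k ≠ i → (x₀₁ k ⟶ z₀ k))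
    (δ₀ : x₀₀ i ⊗ x₀₁ i ⟶ z₀ i)
    (q₁₀ : ∀ k, k ≠ i → (x₁₀ k ⟶ z₁ k)) (q₁₁ : ∀ k, k ≠ i → (x₁₁ k ⟶ z₁ k))
    (δ₁ : x₁₀ i ⊗ x₁₁ i ⟶ z₁ i)
    (q₀ : ∀ k, k ≠ i → (z₀ k ⟶ w k)) (q₁ : ∀ k, k ≠ i → (z₁ k ⟶ w k)) (δ : z₀ i ⊗ z₁ i ⟶ w i)
    (h₀₀ : ∀ k hk, p₀₀ k hk ≫ p₀ k hk = q₀₀ k hk ≫ q₀ k hk)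
    (h₁₀ : ∀ k hk, p₁₀ k hk ≫ p₀ k hk = q₁₀ k hk ≫ q₁ k hk)
    (h₀₁ : ∀ k hk, p₀₁ k hk ≫ p₁ k hk = q₀₁ k hk ≫ q₀ k hk)
    (h₁₁ : ∀ k hk, p₁₁ k hk ≫ p₁ k hk = q₁₁ k hk ≫ q₁ k hk)
    (h : (γ₀ ⊗ₘ γ₁) ≫ γ = tensorμ _ _ _ _ ≫ (δ₀ ⊗ₘ δ₁) ≫ δ) :
    (addHom Φ i p₀₀ p₁₀ γ₀ ⊗ₘ addHom Φ i p₀₁ p₁₁ γ₁) ≫ addHom Φ i p₀ p₁ γ =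
      tensorμ _ _ _ _ ≫ (addHom Φ i q₀₀ q₀₁ δ₀ ⊗ₘ addHom Φ i q₁₀ q₁₁ δ₁) ≫
        addHom Φ i q₀ q₁ δ := by
  let _ : (insAt i (others i w) ⋙ Φ).LaxBraided := { braided := fun a a' => hb _ a a' }
  -- By `h`, the exchange in `E i` splits off as a value of the partial functor; braidedness then
  -- turns it into the exchange in `A`.
  have hs : glue i (u := (insAt i (others i w)).obj ((x₀₀ i ⊗ x₁₀ i) ⊗ (x₀₁ i ⊗ x₁₁ i))) (w := w)
        (fun k hk => eqToHom (insAt_obj_ne i _ _ k hk))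
        (eqToHom (insAt_obj_self i _ _) ≫ (γ₀ ⊗ₘ γ₁) ≫ γ) =
      (insAt i (others i w)).map (tensorμ _ _ _ _) ≫
      glue i (fun k hk => eqToHom (insAt_obj_ne i _ _ k hk))
        (eqToHom (insAt_obj_self i _ _) ≫ (δ₀ ⊗ₘ δ₁) ≫ δ) := by
    rw [h]
    apply hom_ext_at i
    · simp [insAt_map_self]
    · intro k hk
      simp [hk, insAt_map_ne _ _ _ _ hk]
  rw [hΦ.addHom_comp_addHom, hΦ.addHom_comp_addHom, hs, Φ.map_comp]
  simp only [h₀₀, h₁₀, h₀₁, h₁₁]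
  have key := MonoidalCategory.tensorμ_comp_μ_tensorHom_μ_comp_μ (insAt i (others i w) ⋙ Φ)
    (x₀₀ i) (x₁₀ i) (x₀₁ i) (x₁₁ i) =≫ Φ.map (glue i
      (fun k hk => eqToHom (insAt_obj_ne i (others i w) _ k hk))
      (eqToHom (insAt_obj_self i _ _) ≫ (δ₀ ⊗ₘ δ₁) ≫ δ))
  simp only [Category.assoc] at key
  rw [← tensorμ_natural_assoc]
  exact congrArg (_ ≫ ·) key.symm

end DiagonalInterchange

/-! ### Interchange and braiding for composites. -/

section BlocksInterchange

variable {ι : Type w} {κ : ι → Type w'}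
  {E : ι → Type u'} [∀ i, Category.{v'} (E i)] [∀ i, MonoidalCategory (E i)]
  {E' : (i : ι) → κ i → Type u'} [∀ i a, Category.{v'} (E' i a)]
  [∀ i a, MonoidalCategory (E' i a)]
  {A : Type u'} [Category.{v'} A] [MonoidalCategory A]
  {R : ∀ i, (∀ a, E' i a) ⥤ E i} {Φ : (∀ i, E i) ⥤ A}
  [∀ i a x, (insAt a x ⋙ R i).Monoidal] [∀ i x, (insAt i x ⋙ Φ).Monoidal]

open Functor.LaxMonoidal (μ μ_natural)

local notation "𝓔" => fun r : (i : ι) × κ i => E' (Sigma.fst r) (Sigma.snd r)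

attribute [local instance] blocksMonoidal

theorem IsNaturalInOthers.map_addHom {ι : Type w} {E : ι → Type u'} [∀ i, Category.{v'} (E i)]
    [∀ i, MonoidalCategory (E i)] {Φ : (∀ i, E i) ⥤ A} [∀ i x, (insAt i x ⋙ Φ).LaxMonoidal]
    (hΦ : IsNaturalInOthers Φ) (i : ι) {u v w u' v' : ∀ k, E k} (f : u' ⟶ u) (g : v' ⟶ v)
    (α : ∀ k, k ≠ i → (u k ⟶ w k)) (β : ∀ k, k ≠ i → (v k ⟶ w k)) (γ : u i ⊗ v i ⟶ w i) :
    (Φ.map f ⊗ₘ Φ.map g) ≫ addHom Φ i α β γ =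
      addHom Φ i (fun k hk => f k ≫ α k hk) (fun k hk => g k ≫ β k hk) ((f i ⊗ₘ g i) ≫ γ) := by
  simpa using hΦ.map_addHom_map i f g (𝟙 w) α β γ

theorem IsNaturalInOthers.addHom_map {ι : Type w} {E : ι → Type u'} [∀ i, Category.{v'} (E i)]
    [∀ i, MonoidalCategory (E i)] {Φ : (∀ i, E i) ⥤ A} [∀ i x, (insAt i x ⋙ Φ).LaxMonoidal]
    (hΦ : IsNaturalInOthers Φ) (i : ι) {u v w w' : ∀ k, E k} (h : w ⟶ w')
    (α : ∀ k, k ≠ i → (u k ⟶ w k)) (β : ∀ k, k ≠ i → (v k ⟶ w k)) (γ : u i ⊗ v i ⟶ w i) :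
    addHom Φ i α β γ ≫ Φ.map h =
      addHom Φ i (fun k hk => α k hk ≫ h k) (fun k hk => β k hk ≫ h k) (γ ≫ h i) := by
  simpa using hΦ.map_addHom_map i (𝟙 u) (𝟙 v) h α β γ

/-- Variables from different blocks: the square for `Φ` in `i`, `j` is filled with the values of the
`R k`. Its hypotheses hold by functoriality of `R k` in the remaining blocks, and in the blocks `i`
and `j` by absorption of morphisms into the `addHom` of `R i` and `R j`. -/
theorem blocks_addInterchange_of_ne [BraidedCategory A] (hΦ : IsNaturalInOthers Φ)
    (hR : ∀ i, IsNaturalInOthers (R i)) {i j : ι} (hij : i ≠ j) (hI : AddInterchange Φ i j)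
    (a : κ i) (b : κ j) :
    AddInterchange (E := 𝓔) (blocks R ⋙ Φ) ⟨i, a⟩ ⟨j, b⟩ := by
  intro x₀₀ x₁₀ x₀₁ x₁₁ y₀ y₁ z₀ z₁ w p₀₀ p₁₀ γ₀ p₀₁ p₁₁ γ₁ p₀ p₁ γ q₀₀ q₀₁ δ₀ q₁₀ q₁₁ δ₁ q₀ q₁ δ
    _ h₀₀ h₁₀ h₀₁ h₁₁ hγ₀ hγ₁ hδ₀ hδ₁
  have ne {k l : ι} (h : k ≠ l) (c : κ k) (d : κ l) : (⟨k, c⟩ : (i : ι) × κ i) ≠ ⟨l, d⟩ :=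
    fun h' => h (congrArg Sigma.fst h')
  have ne' {k : ι} {c d : κ k} (h : c ≠ d) : (⟨k, c⟩ : (i : ι) × κ i) ≠ ⟨k, d⟩ :=
    fun h' => h (eq_of_heq (Sigma.mk.inj h').2)
  simp only [addHom_blocks hΦ hR]
  unfold blocksAddHom
  apply hI _ _ _ _ _ _ _ _ _ _ _ _ _ _ _ _ _ _ hij
  · intro k hi hj
    exact ((CommSq.mk (funext fun c => h₀₀ ⟨k, c⟩ (ne hi _ _) (ne hj _ _))).map (R k)).w
  · intro k hi hj
    exact ((CommSq.mk (funext fun c => h₁₀ ⟨k, c⟩ (ne hi _ _) (ne hj _ _))).map (R k)).w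
  · intro k hi hj
    exact ((CommSq.mk (funext fun c => h₀₁ ⟨k, c⟩ (ne hi _ _) (ne hj _ _))).map (R k)).w
  · intro k hi hj
    exact ((CommSq.mk (funext fun c => h₁₁ ⟨k, c⟩ (ne hi _ _) (ne hj _ _))).map (R k)).w
  · refine ((hR i).addHom_map a _ _ _ _).trans (Eq.trans ?_ ((hR i).map_addHom a _ _ _ _ _).symm)
    congr 1
    · exact funext fun c => funext fun hc => h₀₀ ⟨i, c⟩ (ne' hc) (ne hij _ _)
    · exact funext fun c => funext fun hc => h₁₀ ⟨i, c⟩ (ne' hc) (ne hij _ _)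
  · refine ((hR i).addHom_map a _ _ _ _).trans (Eq.trans ?_ ((hR i).map_addHom a _ _ _ _ _).symm)
    congr 1
    · exact funext fun c => funext fun hc => h₀₁ ⟨i, c⟩ (ne' hc) (ne hij _ _)
    · exact funext fun c => funext fun hc => h₁₁ ⟨i, c⟩ (ne' hc) (ne hij _ _)
  · refine ((hR j).addHom_map b _ _ _ _).trans (Eq.trans ?_ ((hR j).map_addHom b _ _ _ _ _).symm)
    congr 1
    · exact funext fun c => funext fun hc => (h₀₀ ⟨j, c⟩ (ne hij.symm _ _) (ne' hc)).symm
    · exact funext fun c => funext fun hc => (h₀₁ ⟨j, c⟩ (ne hij.symm _ _) (ne' hc)).symm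
  · refine ((hR j).addHom_map b _ _ _ _).trans (Eq.trans ?_ ((hR j).map_addHom b _ _ _ _ _).symm)
    congr 1
    · exact funext fun c => funext fun hc => (h₁₀ ⟨j, c⟩ (ne hij.symm _ _) (ne' hc)).symm
    · exact funext fun c => funext fun hc => (h₁₁ ⟨j, c⟩ (ne hij.symm _ _) (ne' hc)).symm

/-- Variables from the same block: the interchange for `R i` is the identity among `i`-th
coordinates that `addHom_interchange_self` asks for, and `hb` lets `Φ` transport it. -/
theorem blocks_addInterchange_of_eq [∀ i, BraidedCategory (E i)] [BraidedCategory A]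
    (hΦ : IsNaturalInOthers Φ) (hR : ∀ i, IsNaturalInOthers (R i)) {i : ι}
    (hb : ∀ (x : ∀ j : {j // j ≠ i}, E j) (a a' : E i),
      μ (insAt i x ⋙ Φ) a a' ≫ (insAt i x ⋙ Φ).map (β_ a a').hom =
        (β_ ((insAt i x ⋙ Φ).obj a) ((insAt i x ⋙ Φ).obj a')).hom ≫ μ (insAt i x ⋙ Φ) a' a)
    {a b : κ i} (hI : AddInterchange (R i) a b) :
    AddInterchange (E := 𝓔) (blocks R ⋙ Φ) ⟨i, a⟩ ⟨i, b⟩ := by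
  intro x₀₀ x₁₀ x₀₁ x₁₁ y₀ y₁ z₀ z₁ w p₀₀ p₁₀ γ₀ p₀₁ p₁₁ γ₁ p₀ p₁ γ q₀₀ q₀₁ δ₀ q₁₀ q₁₁ δ₁ q₀ q₁ δ
    hne h₀₀ h₁₀ h₀₁ h₁₁ hγ₀ hγ₁ hδ₀ hδ₁
  have ne {k l : ι} (h : k ≠ l) (c : κ k) (d : κ l) : (⟨k, c⟩ : (i : ι) × κ i) ≠ ⟨l, d⟩ :=
    fun h' => h (congrArg Sigma.fst h')
  have ne' {k : ι} {c d : κ k} (h : c ≠ d) : (⟨k, c⟩ : (i : ι) × κ i) ≠ ⟨k, d⟩ :=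
    fun h' => h (eq_of_heq (Sigma.mk.inj h').2)
  have hab : a ≠ b := fun h => hne (by rw [h])
  simp only [addHom_blocks hΦ hR]
  unfold blocksAddHom
  apply hΦ.addHom_interchange_self i hb
  · intro k hk
    exact ((CommSq.mk (funext fun c => h₀₀ ⟨k, c⟩ (ne hk _ _) (ne hk _ _))).map (R k)).w
  · intro k hk
    exact ((CommSq.mk (funext fun c => h₁₀ ⟨k, c⟩ (ne hk _ _) (ne hk _ _))).map (R k)).w
  · intro k hk
    exact ((CommSq.mk (funext fun c => h₀₁ ⟨k, c⟩ (ne hk _ _) (ne hk _ _))).map (R k)).w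
  · intro k hk
    exact ((CommSq.mk (funext fun c => h₁₁ ⟨k, c⟩ (ne hk _ _) (ne hk _ _))).map (R k)).w
  · exact hI _ _ _ _ _ _ _ _ _ _ _ _ _ _ _ _ _ _ hab
      (fun k ha hb => h₀₀ ⟨i, k⟩ (ne' ha) (ne' hb)) (fun k ha hb => h₁₀ ⟨i, k⟩ (ne' ha) (ne' hb))
      (fun k ha hb => h₀₁ ⟨i, k⟩ (ne' ha) (ne' hb)) (fun k ha hb => h₁₁ ⟨i, k⟩ (ne' ha) (ne' hb))
      hγ₀ hγ₁ hδ₀ hδ₁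

/-- Braidedness in the variable `i` in the language of `addHom`; naturality of the braiding disposes
of the comparison morphisms. -/
theorem braiding_addHom {ι : Type w} {E : ι → Type u'} [∀ i, Category.{v'} (E i)]
    [∀ i, MonoidalCategory (E i)] {Φ : (∀ i, E i) ⥤ A} [∀ i x, (insAt i x ⋙ Φ).LaxMonoidal]
    [∀ i, BraidedCategory (E i)] [BraidedCategory A] {i : ι}
    (hb : ∀ (x : ∀ j : {j // j ≠ i}, E j) (a a' : E i),
      μ (insAt i x ⋙ Φ) a a' ≫ (insAt i x ⋙ Φ).map (β_ a a').hom =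
        (β_ ((insAt i x ⋙ Φ).obj a) ((insAt i x ⋙ Φ).obj a')).hom ≫ μ (insAt i x ⋙ Φ) a' a)
    {u v w : ∀ k, E k} (α : ∀ k, k ≠ i → (u k ⟶ w k)) (β : ∀ k, k ≠ i → (v k ⟶ w k))
    (γ : v i ⊗ u i ⟶ w i) :
    (β_ (Φ.obj u) (Φ.obj v)).hom ≫ addHom Φ i β α γ =
      addHom Φ i α β ((β_ (u i) (v i)).hom ≫ γ) := by
  have hs : glue i (u := (insAt i (others i w)).obj (u i ⊗ v i)) (w := w)
        (fun k hk => eqToHom (insAt_obj_ne i _ _ k hk))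
        (eqToHom (insAt_obj_self i _ _) ≫ (β_ (u i) (v i)).hom ≫ γ) =
      (insAt i (others i w)).map (β_ (u i) (v i)).hom ≫
      glue i (fun k hk => eqToHom (insAt_obj_ne i _ _ k hk))
        (eqToHom (insAt_obj_self i _ _) ≫ γ) := by
    apply hom_ext_at i
    · simp [insAt_map_self]
    · intro k hk
      simp [hk, insAt_map_ne _ _ _ _ hk]
  unfold addHom
  rw [hs, Φ.map_comp, ← BraidedCategory.braiding_naturality_assoc]
  have key := hb (others i w) (u i) (v i)
  dsimp only [Functor.comp_map, Functor.comp_obj] at key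
  rw [reassoc_of% key]

/-- After passing to nested `addHom`, `braiding_addHom` is applied twice: for `Φ`, which moves the
braiding into `E q.1`, and for `R q.1`, which moves it into the varying coordinate. -/
theorem blocks_braided [∀ i, BraidedCategory (E i)] [∀ i a, BraidedCategory (E' i a)]
    [BraidedCategory A] (hΦ : IsNaturalInOthers Φ) (hR : ∀ i, IsNaturalInOthers (R i))
    (hb : ∀ (i : ι) (x : ∀ j : {j // j ≠ i}, E j) (a a' : E i),
      μ (insAt i x ⋙ Φ) a a' ≫ (insAt i x ⋙ Φ).map (β_ a a').hom =
        (β_ ((insAt i x ⋙ Φ).obj a) ((insAt i x ⋙ Φ).obj a')).hom ≫ μ (insAt i x ⋙ Φ) a' a)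
    (hb' : ∀ (i : ι) (c : κ i) (x : ∀ j : {j // j ≠ c}, E' i j) (a a' : E' i c),
      μ (insAt c x ⋙ R i) a a' ≫ (insAt c x ⋙ R i).map (β_ a a').hom =
        (β_ ((insAt c x ⋙ R i).obj a) ((insAt c x ⋙ R i).obj a')).hom ≫ μ (insAt c x ⋙ R i) a' a)
    (q : (i : ι) × κ i) (x : ∀ r : {r // r ≠ q}, E' r.1.1 r.1.2) (a a' : E' q.1 q.2) :
    μ (insAt (E := 𝓔) q x ⋙ blocks R ⋙ Φ) a a' ≫
      (insAt (E := 𝓔) q x ⋙ blocks R ⋙ Φ).map (β_ a a').hom =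
    (β_ ((insAt (E := 𝓔) q x ⋙ blocks R ⋙ Φ).obj a)
        ((insAt (E := 𝓔) q x ⋙ blocks R ⋙ Φ).obj a')).hom ≫
      μ (insAt (E := 𝓔) q x ⋙ blocks R ⋙ Φ) a' a := by
  have l := blocks_map_μ_map hΦ hR q
    (𝟙 ((insAt (E := 𝓔) q x).obj a))
    (𝟙 ((insAt (E := 𝓔) q x).obj a'))
    ((insAt (E := 𝓔) q x).map (β_ a a').hom)
  have r := blocks_map_μ_map hΦ hR q
    (𝟙 ((insAt (E := 𝓔) q x).obj a'))
    (𝟙 ((insAt (E := 𝓔) q x).obj a))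
    (𝟙 ((insAt (E := 𝓔) q x).obj (a' ⊗ a)))
  simp only [CategoryTheory.Functor.map_id, id_tensorHom_id] at l r
  erw [Category.id_comp] at l r
  erw [Category.comp_id] at r
  have ne (z : E' q.1 q.2) (k : (i : ι) × κ i) (hk : k ≠ q) :
      (insAt (E := 𝓔) q x).obj z k = (insAt (E := 𝓔) q x).obj (a' ⊗ a) k :=
    (insAt_obj_ne (E := 𝓔) q x _ k hk).trans (insAt_obj_ne (E := 𝓔) q x _ k hk).symm
  let γ : (insAt (E := 𝓔) q x).obj a' q ⊗ (insAt (E := 𝓔) q x).obj a q ⟶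
      (insAt (E := 𝓔) q x).obj (a' ⊗ a) q :=
    (eqToHom (insAt_obj_self (E := 𝓔) q x a') ⊗ₘ eqToHom (insAt_obj_self (E := 𝓔) q x a)) ≫
      eqToHom (insAt_obj_self (E := 𝓔) q x (a' ⊗ a)).symm
  have l' := l.trans (show _ = blocksAddHom R Φ q (fun k hk => eqToHom (ne a k hk))
      (fun k hk => eqToHom (ne a' k hk)) ((β_ _ _).hom ≫ γ) by
    congr 1
    · funext k hk
      simp [insAt_map_ne _ _ _ _ hk]
    · funext k hk
      simp [insAt_map_ne _ _ _ _ hk]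
    · rw [← BraidedCategory.braiding_naturality_assoc]
      simp [insAt_map_self])
  have r' := r.trans (show _ = blocksAddHom R Φ q (fun k hk => eqToHom (ne a' k hk))
      (fun k hk => eqToHom (ne a k hk)) γ by
    congr 1
    · funext k hk
      simp
    · funext k hk
      simp
    · simp [γ])
  refine l'.trans (Eq.trans ?_ (congrArg (_ ≫ ·) r'.symm))
  unfold blocksAddHom
  refine Eq.trans ?_ (braiding_addHom (hb q.1) _ _ _).symm
  congr 1
  exact (braiding_addHom (hb' q.1 q.2) _ _ _).symm

end BlocksInterchange

/-! ### Compatibility with monoidal functors between the sources and the targets -/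

section Restriction

variable {ι : Type w}
  {E : ι → Type u'} [∀ i, Category.{v'} (E i)]
  {E₂ : ι → Type u'} [∀ i, Category.{v'} (E₂ i)]
  {T : ∀ i, E i ⥤ E₂ i}

theorem insAt_obj_pi (i : ι) (x : ∀ j : {j // j ≠ i}, E j) (a : E i) :
    (Functor.pi T).obj ((insAt i x).obj a) =
      (insAt i fun j => (T j).obj (x j)).obj ((T i).obj a) :=
  Functor.congr_obj (insAt_comp_pi T i x) a

variable [∀ i, MonoidalCategory (E i)] [∀ i, MonoidalCategory (E₂ i)]
  {A : Type u'} [Category.{v'} A] [MonoidalCategory A]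
  {A₂ : Type u'} [Category.{v'} A₂] [MonoidalCategory A₂]
  {Φ : (∀ i, E i) ⥤ A} [∀ i x, (insAt i x ⋙ Φ).LaxMonoidal]
  {Φ₂ : (∀ i, E₂ i) ⥤ A₂} [∀ i x, (insAt i x ⋙ Φ₂).LaxMonoidal]
  {S : A ⥤ A₂}

open Functor.LaxMonoidal (μ μ_natural)

variable (ρ : Φ ⋙ S ⟶ Functor.pi T ⋙ Φ₂)

/-- `ρ` as a transformation of functors of the `i`-th variable. -/
def partialTrans (i : ι) (x : ∀ j : {j // j ≠ i}, E j) :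
    (insAt i x ⋙ Φ) ⋙ S ⟶ T i ⋙ insAt i (fun j => (T j).obj (x j)) ⋙ Φ₂ where
  app a := ρ.app ((insAt i x).obj a) ≫ Φ₂.map (eqToHom (insAt_obj_pi i x a))
  naturality a b f := by
    have h := Functor.congr_hom (insAt_comp_pi T i x) f
    have hρ := ρ.naturality ((insAt i x).map f)
    dsimp at h hρ ⊢
    rw [reassoc_of% hρ, Category.assoc, ← Φ₂.map_comp, ← Φ₂.map_comp]
    congr 2
    rw [h]
    simp

variable [∀ i, (T i).LaxMonoidal] [S.LaxMonoidal]

/-- `ρ` is compatible with `addHom` and `unitHom`. -/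
structure IsAddCompatible : Prop where
  add (i : ι) {u v w : ∀ k, E k} (α : ∀ k, k ≠ i → (u k ⟶ w k)) (β : ∀ k, k ≠ i → (v k ⟶ w k))
    (γ : u i ⊗ v i ⟶ w i) :
    μ S (Φ.obj u) (Φ.obj v) ≫ S.map (addHom Φ i α β γ) ≫ ρ.app w =
      (ρ.app u ⊗ₘ ρ.app v) ≫ addHom Φ₂ i (u := (Functor.pi T).obj u) (v := (Functor.pi T).obj v)
        (w := (Functor.pi T).obj w) (fun k hk => (T k).map (α k hk))
        (fun k hk => (T k).map (β k hk)) (μ (T i) (u i) (v i) ≫ (T i).map γ)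
  unit (i : ι) {w : ∀ k, E k} (γ : 𝟙_ (E i) ⟶ w i) :
    Functor.LaxMonoidal.ε S ≫ S.map (unitHom Φ i γ) ≫ ρ.app w =
      unitHom Φ₂ i (w := (Functor.pi T).obj w) (Functor.LaxMonoidal.ε (T i) ≫ (T i).map γ)

variable {ρ}

/-- Monoidality is used only with the parameters `others i w`; naturality of `ρ` carries the
comparison morphisms across, and `map_μ_map` for `Φ₂` collects them. -/
theorem isAddCompatible_of_isMonoidal (hΦ₂ : IsNaturalInOthers Φ₂)
    (h : ∀ i x, NatTrans.IsMonoidal (partialTrans ρ i x)) : IsAddCompatible ρ where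
  add i u v w α β γ := by
    have t := (h i (others i w)).tensor (u i) (v i)
    dsimp only [partialTrans, Functor.comp_obj] at t
    rw [Functor.LaxMonoidal.comp_μ, Functor.LaxMonoidal.comp_μ, ← Category.assoc,
      ← IsIso.eq_comp_inv] at t
    simp only [Category.assoc, Functor.comp_obj, ← Functor.map_inv, inv_eqToHom,
      Functor.comp_map] at t
    conv_lhs => unfold addHom
    rw [S.map_comp, S.map_comp, Category.assoc, Category.assoc]
    have hρ {u v} (f : u ⟶ v) := ρ.naturality f
    dsimp only [Functor.comp_map, Functor.comp_obj] at hρ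
    rw [← Functor.LaxMonoidal.μ_natural_assoc, hρ, reassoc_of% t, tensorHom_comp_tensorHom_assoc,
      reassoc_of% hρ, reassoc_of% hρ, ← Φ₂.map_comp, ← Φ₂.map_comp, ← tensorHom_comp_tensorHom,
      ← Φ₂.map_comp, ← Φ₂.map_comp, Category.assoc]
    congr 1
    refine (hΦ₂.map_μ_map i _ _ _).trans ?_
    congr 1
    · funext k hk
      simp only [Functor.pi_map, Pi.comp_apply, glue_ne _ _ _ _ hk,
        insAt_map_ne _ _ _ _ hk, pi_eqToHom_apply, Functor.map_comp, eqToHom_map]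
      delta Functor.pi
      dsimp only
      simp
    · funext k hk
      simp only [Functor.pi_map, Pi.comp_apply, glue_ne _ _ _ _ hk,
        insAt_map_ne _ _ _ _ hk, pi_eqToHom_apply, Functor.map_comp, eqToHom_map]
      delta Functor.pi
      dsimp only
      simp
    · simp only [Functor.pi_map, Pi.comp_apply, glue_self, insAt_map_self, pi_eqToHom_apply,
        Functor.map_comp, eqToHom_map]
      delta Functor.pi
      dsimp only
      simp
  unit i w γ := by
    have t := (h i (others i w)).unit
    dsimp only [partialTrans, Functor.comp_obj] at t
    rw [Functor.LaxMonoidal.comp_ε, Functor.LaxMonoidal.comp_ε, ← Category.assoc,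
      ← IsIso.eq_comp_inv] at t
    simp only [Category.assoc, Functor.comp_obj, ← Functor.map_inv, inv_eqToHom,
      Functor.comp_map] at t
    conv_lhs => unfold unitHom
    have hρ {u v} (f : u ⟶ v) := ρ.naturality f
    dsimp only [Functor.comp_map, Functor.comp_obj] at hρ
    rw [S.map_comp, Category.assoc, hρ, reassoc_of% t, ← Φ₂.map_comp, ← Φ₂.map_comp, hΦ₂.ε_map]
    congr 1
    simp only [Functor.pi_map, Pi.comp_apply, glue_self, insAt_map_self, pi_eqToHom_apply,
      Functor.map_comp, eqToHom_map]
    delta Functor.pi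
    dsimp only
    simp

/-- The structure morphism of `Φ` is itself an `addHom`, by the normal form with identities, so
compatibility specialises to it; normal forms over `Φ₂` are then compared. -/
theorem IsAddCompatible.isMonoidal (hΦ : IsNaturalInOthers Φ) (hΦ₂ : IsNaturalInOthers Φ₂)
    (h : IsAddCompatible ρ) (i : ι) (x : ∀ j : {j // j ≠ i}, E j) :
    NatTrans.IsMonoidal (partialTrans ρ i x) := by
  refine ⟨?_, fun a a' => ?_⟩
  · have e := hΦ.ε_map i (𝟙 ((insAt i x).obj (𝟙_ (E i))))
    rw [Φ.map_id] at e
    erw [Category.comp_id] at e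
    dsimp only [partialTrans, Functor.comp_obj]
    rw [Functor.LaxMonoidal.comp_ε, Functor.LaxMonoidal.comp_ε, e, Category.assoc]
    erw [reassoc_of% (h.unit i _)]
    rw [hΦ₂.unitHom_map, Functor.comp_map, hΦ₂.ε_map]
    congr 1
    simp only [insAt_map_self, pi_eqToHom_apply,
      Functor.map_comp, eqToHom_map, Pi.id_apply, CategoryTheory.Functor.map_id]
    delta Functor.pi
    dsimp only
    simp
  · have e := hΦ.map_μ_map i (𝟙 ((insAt i x).obj a)) (𝟙 ((insAt i x).obj a'))
      (𝟙 ((insAt i x).obj (a ⊗ a')))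
    simp only [Φ.map_id, id_tensorHom_id] at e
    erw [Category.id_comp, Category.comp_id] at e
    dsimp only [partialTrans, Functor.comp_obj]
    rw [Functor.LaxMonoidal.comp_μ, Functor.LaxMonoidal.comp_μ, e, Category.assoc]
    erw [reassoc_of% (h.add i _ _ _)]
    rw [← tensorHom_comp_tensorHom (ρ.app _) (ρ.app _), Category.assoc, Functor.comp_map]
    refine congrArg ((ρ.app ((insAt i x).obj a) ⊗ₘ ρ.app ((insAt i x).obj a')) ≫ ·) ?_
    refine (hΦ₂.addHom_map i _ _ _ _).trans (Eq.trans ?_ (hΦ₂.map_μ_map i _ _ _).symm)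
    congr 1
    · funext k hk
      simp only [insAt_map_ne _ _ _ _ hk, pi_eqToHom_apply, Functor.map_comp, eqToHom_map,
        Pi.id_apply, CategoryTheory.Functor.map_id]
      delta Functor.pi
      dsimp only
      simp
    · funext k hk
      simp only [insAt_map_ne _ _ _ _ hk, pi_eqToHom_apply, Functor.map_comp, eqToHom_map,
        Pi.id_apply, CategoryTheory.Functor.map_id]
      delta Functor.pi
      dsimp only
      simp
    · simp only [insAt_map_self, pi_eqToHom_apply,
        Functor.map_comp, eqToHom_map, Pi.id_apply, CategoryTheory.Functor.map_id]
      delta Functor.pi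
      dsimp only
      simp
      rw [← Functor.LaxMonoidal.μ_natural_assoc]
      simp [eqToHom_map]

end Restriction

/-! ### Compatibility with restriction for composites. -/

section BlocksRestriction

variable {ι : Type w} {κ : ι → Type w'}
  {E : ι → Type u'} [∀ i, Category.{v'} (E i)] [∀ i, MonoidalCategory (E i)]
  {E₂ : ι → Type u'} [∀ i, Category.{v'} (E₂ i)] [∀ i, MonoidalCategory (E₂ i)]
  {E' : (i : ι) → κ i → Type u'} [∀ i a, Category.{v'} (E' i a)]
  [∀ i a, MonoidalCategory (E' i a)]
  {E₂' : (i : ι) → κ i → Type u'} [∀ i a, Category.{v'} (E₂' i a)]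
  [∀ i a, MonoidalCategory (E₂' i a)]
  {A : Type u'} [Category.{v'} A] [MonoidalCategory A]
  {A₂ : Type u'} [Category.{v'} A₂] [MonoidalCategory A₂]
  {R : ∀ i, (∀ a, E' i a) ⥤ E i} {Φ : (∀ i, E i) ⥤ A}
  [∀ i a x, (insAt a x ⋙ R i).Monoidal] [∀ i x, (insAt i x ⋙ Φ).Monoidal]
  {R₂ : ∀ i, (∀ a, E₂' i a) ⥤ E₂ i} {Φ₂ : (∀ i, E₂ i) ⥤ A₂}
  [∀ i a x, (insAt a x ⋙ R₂ i).Monoidal] [∀ i x, (insAt i x ⋙ Φ₂).Monoidal]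
  {T : ∀ i, E i ⥤ E₂ i} [∀ i, (T i).LaxMonoidal]
  {T' : ∀ i a, E' i a ⥤ E₂' i a} [∀ i a, (T' i a).LaxMonoidal] {S : A ⥤ A₂} [S.LaxMonoidal]

local notation "𝓔" => fun r : (i : ι) × κ i => E' (Sigma.fst r) (Sigma.snd r)

attribute [local instance] blocksMonoidal

open Functor.LaxMonoidal (μ μ_natural)

/-- Pasting of two layers: `hρ` treats the outer addition; inside it, the blocks away from `q` match
by naturality of `σ j` and the block of `q` by `hσ q.1`. -/
theorem isAddCompatible_blocks (hΦ : IsNaturalInOthers Φ) (hR : ∀ i, IsNaturalInOthers (R i))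
    (hΦ₂ : IsNaturalInOthers Φ₂) (hR₂ : ∀ i, IsNaturalInOthers (R₂ i))
    {ρ : Φ ⋙ S ⟶ Functor.pi T ⋙ Φ₂} (hρ : IsAddCompatible ρ)
    {σ : ∀ i, R i ⋙ T i ⟶ Functor.pi (T' i) ⋙ R₂ i} (hσ : ∀ i, IsAddCompatible (σ i))
    {τ : (blocks R ⋙ Φ) ⋙ S ⟶
      Functor.pi (fun q : (i : ι) × κ i => T' q.1 q.2) ⋙ (blocks R₂ ⋙ Φ₂)}
    (hτ : ∀ x, τ.app x = ρ.app ((blocks R).obj x) ≫ Φ₂.map fun i => (σ i).app ((block i).obj x)) :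
    IsAddCompatible (E := 𝓔)
      (E₂ := fun r => E₂' r.1 r.2) τ where
  add q u v w α β γ := by
    refine Eq.trans ?_ (congrArg ((τ.app u ⊗ₘ τ.app v) ≫ ·)
      (addHom_blocks hΦ₂ hR₂ q _ _ _).symm)
    rw [addHom_blocks hΦ hR, hτ, hτ, hτ]
    refine Eq.trans ?_ (congrArg (· ≫ _) (tensorHom_comp_tensorHom _ _ _ _))
    refine Eq.trans ?_ (Category.assoc _ _ _).symm
    have e := hρ.add q.1 (u := (blocks R).obj u) (v := (blocks R).obj v) (w := (blocks R).obj w)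
      (fun j hj => (R j).map fun b => α ⟨j, b⟩ fun h => hj (congrArg Sigma.fst h))
      (fun j hj => (R j).map fun b => β ⟨j, b⟩ fun h => hj (congrArg Sigma.fst h))
      (addHom (R q.1) q.2 (u := (block q.1).obj u) (v := (block q.1).obj v)
        (w := (block q.1).obj w)
        (fun b hb => α ⟨q.1, b⟩ fun h => hb (eq_of_heq (Sigma.mk.inj h).2))
        (fun b hb => β ⟨q.1, b⟩ fun h => hb (eq_of_heq (Sigma.mk.inj h).2)) γ)
    refine (reassoc_of% e) _ |>.trans ?_
    refine congrArg ((ρ.app _ ⊗ₘ ρ.app _) ≫ ·) ?_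
    refine (hΦ₂.addHom_map q.1 _ _ _ _).trans (Eq.trans ?_ (hΦ₂.map_addHom q.1 _ _ _ _ _).symm)
    congr 1
    · funext j hj
      exact (σ j).naturality _
    · funext j hj
      exact (σ j).naturality _
    · exact (Category.assoc _ _ _).trans ((hσ q.1).add q.2
        (u := (block q.1).obj u) (v := (block q.1).obj v) (w := (block q.1).obj w) _ _ γ)
  unit q w γ := by
    refine Eq.trans ?_ (unitHom_blocks hΦ₂ hR₂ q _).symm
    rw [unitHom_blocks hΦ hR, hτ]
    have e := hρ.unit q.1 (w := (blocks R).obj w)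
      (unitHom (R q.1) q.2 (w := (block q.1).obj w) γ)
    refine (reassoc_of% e) _ |>.trans ?_
    refine (hΦ₂.unitHom_map q.1 _ _).trans ?_
    congr 1
    exact (Category.assoc _ _ _).trans ((hσ q.1).unit q.2 (w := (block q.1).obj w) γ)

end BlocksRestriction

/-! ### Composition of multi-additive functors -/

namespace MultiFunctor

section

variable {C : Type u} [Category.{v} C] {J : GrothendieckTopology C}
  {D : Type t} [Category.{t'} D] {ι : Type w} {p : D ⥤ C} {H : ι → GrStack.{v', u'} J}
  {G : GrStack.{v', u'} J} {F : MultiFunctor p H G}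

theorem partialRes_hom {d e : D} (f : d ⟶ e) (i : ι)
    (x : ∀ j : {j // j ≠ i}, Fib (H j).X (p.obj e)) :
    (F.partialRes f i x).hom = partialTrans (E := fun i => Fib (H i).X (p.obj e))
      (E₂ := fun i => Fib (H i).X (p.obj d)) (T := fun i => res (H i).X (p.map f))
      (F.resIso f).hom i x := by
  ext a
  simp [partialRes, partialTrans, eqToHom_app]

theorem IsBraided.insAt_braided [∀ i, Braiding (H i)] [Braiding G] (hF : F.IsBraided) (d : D)
    (i : ι) (x : ∀ j : {j // j ≠ i}, Fib (H j).X (p.obj d)) (a a' : Fib (H i).X (p.obj d)) :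
    Functor.LaxMonoidal.μ (F.partialFunctor d i x) a a' ≫
        (F.partialFunctor d i x).map (β_ a a').hom =
      (β_ ((F.partialFunctor d i x).obj a) ((F.partialFunctor d i x).obj a')).hom ≫
        Functor.LaxMonoidal.μ (F.partialFunctor d i x) a' a := by
  -- `IsBraided` speaks of full families `z`; the given object `a` serves to fill the missing
  -- coordinate of `x`.
  obtain ⟨z, rfl⟩ : ∃ z : ∀ k, Fib (H k).X (p.obj d), x = others i z :=
    ⟨(insAt (E := fun i => Fib (H i).X (p.obj d)) i x).obj a,
      funext fun j => (insAt_obj_ne (E := fun i => Fib (H i).X (p.obj d)) i x a j.1 j.2).symm⟩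
  exact hF d i z a a'

variable [Braiding G] {r : ι → ι → Prop}

namespace IsMultiAdditive

theorem isNaturalInOthers (hF : F.IsMultiAdditive r) (d : D) :
    IsNaturalInOthers (E := fun i => Fib (H i).X (p.obj d)) (F.app d) :=
  fun i _ _ φ => hF.natural d i φ

theorem isAddCompatible (hF : F.IsMultiAdditive r) {d e : D} (f : d ⟶ e) :
    IsAddCompatible (E := fun i => Fib (H i).X (p.obj e)) (E₂ := fun i => Fib (H i).X (p.obj d))
      (T := fun i => res (H i).X (p.map f)) (F.resIso f).hom :=
  isAddCompatible_of_isMonoidal (hF.isNaturalInOthers d) fun i x => by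
    rw [← partialRes_hom]
    exact hF.natural_res f i x

theorem addInterchange (hF : F.IsMultiAdditive r) (d : D) {i j : ι} (hr : r i j) (hij : i ≠ j) :
    AddInterchange (E := fun i => Fib (H i).X (p.obj d)) (F.app d) i j :=
  InsInterchange.addInterchange (hF.isNaturalInOthers d) hij
    fun z a a' b b' => hF.interchange d i j hr hij z a a' b b'

theorem unitHom_eq (hF : F.IsMultiAdditive r) (d : D) {i j : ι} (hr : r i j) (hij : i ≠ j)
    {w : ∀ k, Fib (H k).X (p.obj d)} (γ : 𝟙_ (Fib (H i).X (p.obj d)) ⟶ w i)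
    (δ : 𝟙_ (Fib (H j).X (p.obj d)) ⟶ w j) :
    unitHom (E := fun i => Fib (H i).X (p.obj d)) (F.app d) i γ =
      unitHom (E := fun i => Fib (H i).X (p.obj d)) (F.app d) j δ :=
  (hF.isNaturalInOthers d).unitHom_eq hij (fun z => hF.unit_eq d i j hr hij z) γ δ

end IsMultiAdditive

end

end MultiFunctor

/-! ### The composite of multi-additive functors is multi-additive and braided. -/

namespace MultiFunctor

section

variable {C : Type u} [Category.{v} C] {J : GrothendieckTopology C}
  {D : Type t} [Category.{t'} D] {ι : Type w} {κ : ι → Type w'} {p : D ⥤ C}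
  {H : ι → GrStack.{v', u'} J} {K : (i : ι) → κ i → GrStack.{v', u'} J}
  {G : GrStack.{v', u'} J} {F : MultiFunctor p H G} {P : ∀ i, MultiFunctor p (K i) (H i)}

/-- The additivity of `F(P₁, …, Pₙ)` in the variable `q`, for the functor on the fibres over `d`. -/
@[reducible]
def fibreMonoidal (F : MultiFunctor p H G) (P : ∀ i, MultiFunctor p (K i) (H i)) (d : D)
    (q : (i : ι) × κ i) (x : ∀ r : {r // r ≠ q}, Fib (K r.1.1 r.1.2).X (p.obj d)) :
    (insAt (E := fun q : (i : ι) × κ i => Fib (K q.1 q.2).X (p.obj d)) q x ⋙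
      blocks (E' := fun i a => Fib (K i a).X (p.obj d)) (fun i => (P i).app d) ⋙
        F.app d).Monoidal :=
  blocksMonoidal (E' := fun i a => Fib (K i a).X (p.obj d)) (fun i => (P i).app d) (F.app d) q x

attribute [local instance] fibreMonoidal

theorem comp_resIso_hom_app {d e : D} (f : d ⟶ e)
    (x : ∀ q : (i : ι) × κ i, Fib (K q.1 q.2).X (p.obj e)) :
    ((F.comp P).resIso f).hom.app x =
      (F.resIso f).hom.app (fun i => ((P i).app e).obj fun a => x ⟨i, a⟩) ≫
        (F.app d).map fun i => ((P i).resIso f).hom.app fun a => x ⟨i, a⟩ := by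
  change 𝟙 _ ≫ _ ≫ 𝟙 _ ≫ _ ≫ 𝟙 _ = _
  rw [Category.id_comp, Category.id_comp, Category.comp_id]
  rfl

theorem comp_isMultiAdditive [Braiding G] [∀ i, Braiding (H i)] {r : ι → ι → Prop}
    {s : ∀ i, κ i → κ i → Prop} (hr : ∀ i, ¬ r i i)
    (hF : F.IsMultiAdditive r) (hFb : F.IsBraided) (hP : ∀ i, (P i).IsMultiAdditive (s i)) :
    (F.comp P).IsMultiAdditive (Sigma.Lex r s) where
  resIso_id d x := by
    refine (congrArg (· ≫ _) (comp_resIso_hom_app (𝟙 d) x)).trans ((Category.assoc _ _ _).trans ?_)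
    refine (congrArg (_ ≫ ·) ((F.app d).map_comp _ _).symm).trans ?_
    refine Eq.trans ?_ (hF.resIso_id d fun i => ((P i).app d).obj fun a => x ⟨i, a⟩)
    refine congrArg (fun t => _ ≫ (F.app d).map t) (funext fun i => ?_)
    exact (hP i).resIso_id d fun a => x ⟨i, a⟩
  resIso_comp {d e e'} f g x := by
    refine (congrArg (· ≫ _) (comp_resIso_hom_app (f ≫ g) x)).trans
      ((Category.assoc _ _ _).trans ?_)
    rw [comp_resIso_hom_app, comp_resIso_hom_app]
    refine (congrArg (_ ≫ ·) ((F.app d).map_comp _ _).symm).trans ?_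
    have h := fun i => (hP i).resIso_comp f g fun a => x ⟨i, a⟩
    have hF' := hF.resIso_comp f g fun i => ((P i).app e').obj fun a => x ⟨i, a⟩
    -- Pasting of pseudonaturality squares: this naturality exchanges the restriction isomorphism of
    -- `F` along `f` with those of the inner functors along `g`.
    have n := (F.resIso f).hom.naturality
      (fun i => ((P i).resIso g).hom.app fun a => x ⟨i, a⟩)
    refine (congrArg (fun t => _ ≫ (F.app d).map t) (funext fun i => h i)).trans ?_
    refine (congrArg (_ ≫ ·) ((F.app d).map_comp _ _)).trans ?_
    refine ((reassoc_of% hF') _).trans ?_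
    refine (Category.assoc _ _ _).trans (congrArg (_ ≫ ·) ?_)
    refine (Category.assoc _ _ _).trans (Eq.trans ?_
      (congrArg (· ≫ _) ((res G.X (p.map f)).map_comp _ _).symm))
    refine Eq.trans (congrArg (_ ≫ ·) ?_) (Category.assoc _ _ _).symm
    refine (congrArg (_ ≫ ·) ((F.app d).map_comp _ _)).trans ?_
    exact ((reassoc_of% n) _).symm
  natural d q _ _ φ := by
    exact blocks_isNaturalInOthers (hF.isNaturalInOthers d) (fun i => (hP i).isNaturalInOthers d)
      q φ
  natural_res {d e} f q x := by
    rw [partialRes_hom]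
    refine IsAddCompatible.isMonoidal
      (Φ := blocks (E' := fun i a => Fib (K i a).X (p.obj e)) (fun i => (P i).app e) ⋙ F.app e)
      (Φ₂ := blocks (E' := fun i a => Fib (K i a).X (p.obj d)) (fun i => (P i).app d) ⋙ F.app d)
      (blocks_isNaturalInOthers (hF.isNaturalInOthers e) fun i => (hP i).isNaturalInOthers e)
      (blocks_isNaturalInOthers (hF.isNaturalInOthers d) fun i => (hP i).isNaturalInOthers d)
      (isAddCompatible_blocks (hF.isNaturalInOthers e) (fun i => (hP i).isNaturalInOthers e)
        (hF.isNaturalInOthers d) (fun i => (hP i).isNaturalInOthers d)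
        (hF.isAddCompatible f) (fun i => (hP i).isAddCompatible f)
        fun x => comp_resIso_hom_app f x) q x
  interchange d q q' h hne z a a' b b' := by
    have key : AddInterchange (E := fun q : (i : ι) × κ i => Fib (K q.1 q.2).X (p.obj d))
        (blocks (E' := fun i a => Fib (K i a).X (p.obj d)) (fun i => (P i).app d) ⋙ F.app d)
        q q' := by
      -- The lexicographic order separates pairs in different blocks from pairs in one block.
      cases h with
      | @left i j a b h =>
        -- Irreflexivity of the order of the outer variables guarantees that this case really
        -- concerns two distinct variables of `F`.
        have hij : i ≠ j := fun e => hr j (e ▸ h)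
        exact blocks_addInterchange_of_ne (hF.isNaturalInOthers d)
          (fun i => (hP i).isNaturalInOthers d) hij (hF.addInterchange d h hij) _ _
      | right a b h =>
        exact blocks_addInterchange_of_eq (hF.isNaturalInOthers d)
          (fun i => (hP i).isNaturalInOthers d) (hFb.insAt_braided d _)
          ((hP _).addInterchange d h fun e => hne (by rw [e]))
    exact key.insInterchange (blocks_isNaturalInOthers (hF.isNaturalInOthers d)
      fun i => (hP i).isNaturalInOthers d) hne z a a' b b'
  unit_eq d q q' h hne z := by
    have hn := blocks_isNaturalInOthers (hF.isNaturalInOthers d)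
      fun i => (hP i).isNaturalInOthers d
    refine hn.ε_eq hne (fun w γ δ => ?_) z
    refine (unitHom_blocks (hF.isNaturalInOthers d) (fun i => (hP i).isNaturalInOthers d) q
      γ).trans (Eq.trans ?_ (unitHom_blocks (hF.isNaturalInOthers d)
        (fun i => (hP i).isNaturalInOthers d) q' δ).symm)
    cases h with
    | @left i j a b h => exact hF.unitHom_eq d h (fun e => hr j (e ▸ h)) _ _
    | right a b h =>
      exact congrArg (unitHom (E := fun i => Fib (H i).X (p.obj d)) (F.app d) _)
        ((hP _).unitHom_eq d h (fun e => hne (by rw [e])) _ _)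

theorem comp_isBraided [Braiding G] [∀ i, Braiding (H i)] [∀ i a, Braiding (K i a)]
    {r : ι → ι → Prop} {s : ∀ i, κ i → κ i → Prop}
    (hF : F.IsMultiAdditive r) (hFb : F.IsBraided)
    (hP : ∀ i, (P i).IsMultiAdditive (s i)) (hPb : ∀ i, (P i).IsBraided) :
    (F.comp P).IsBraided := fun d q _ a a' =>
  blocks_braided (hF.isNaturalInOthers d) (fun i => (hP i).isNaturalInOthers d)
    (hFb.insAt_braided d) (fun i => (hPb i).insAt_braided d) q _ a a'

end

end MultiFunctor

/-! ### Associativity -/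

section Flatten

variable {ι : Type w} {κ : ι → Type w'} {μ : (i : ι) → κ i → Type w''}
  {E'' : (i : ι) → (a : κ i) → μ i a → Type u'} [∀ i a c, Category.{v'} (E'' i a c)]

local notation "𝓔₁" => fun q : (i : ι) × (a : κ i) × μ i a => E'' (Sigma.fst q) (Sigma.fst (Sigma.snd q)) (Sigma.snd (Sigma.snd q))
local notation "𝓔₂" => fun q : (r : (i : ι) × κ i) × μ (Sigma.fst r) (Sigma.snd r) => E'' (Sigma.fst (Sigma.fst q)) (Sigma.snd (Sigma.fst q)) (Sigma.snd q)

/-- The coordinates other than `q`, after relabelling. -/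
abbrev flattenOthers (q : (q : (i : ι) × κ i) × μ q.1 q.2)
    (x : ∀ r : {r // r ≠ q}, E'' r.1.1.1 r.1.1.2 r.1.2) :
    ∀ r : {r : (i : ι) × (a : κ i) × μ i a // r ≠ ⟨q.1.1, q.1.2, q.2⟩}, E'' r.1.1 r.1.2.1 r.1.2.2 :=
  fun r => x ⟨⟨⟨r.1.1, r.1.2.1⟩, r.1.2.2⟩,
    fun h => r.2 (congrArg (fun s : (q : (i : ι) × κ i) × μ q.1 q.2 =>
      (⟨s.1.1, s.1.2, s.2⟩ : (i : ι) × (a : κ i) × μ i a)) h)⟩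

theorem flatten_insAt (q : (q : (i : ι) × κ i) × μ q.1 q.2)
    (x : ∀ r : {r // r ≠ q}, E'' r.1.1.1 r.1.1.2 r.1.2) (z : E'' q.1.1 q.1.2 q.2) :
    (flatten (A := E'')).obj
        ((insAt (E := 𝓔₂) q x).obj z) =
      (insAt (E := 𝓔₁)
        ⟨q.1.1, q.1.2, q.2⟩ (flattenOthers q x)).obj z :=
  Functor.congr_obj (insAt_comp_flatten (A := E'') q x) z

end Flatten

/-! ### Associativity of the monoidal structures on the fibres. -/

section Associativity

variable {ι : Type w} {κ : ι → Type w'} {μ : (i : ι) → κ i → Type w''}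
  {E : ι → Type u'} [∀ i, Category.{v'} (E i)] [∀ i, MonoidalCategory (E i)]
  {E' : (i : ι) → κ i → Type u'} [∀ i a, Category.{v'} (E' i a)]
  [∀ i a, MonoidalCategory (E' i a)]
  {E'' : (i : ι) → (a : κ i) → μ i a → Type u'} [∀ i a c, Category.{v'} (E'' i a c)]
  [∀ i a c, MonoidalCategory (E'' i a c)]
  {A : Type u'} [Category.{v'} A] [MonoidalCategory A]

local notation "𝓔₀" => fun i (q : (a : κ i) × μ i a) => E'' i (Sigma.fst q) (Sigma.snd q)
local notation "𝓔₁" => fun q : (i : ι) × (a : κ i) × μ i a => E'' (Sigma.fst q) (Sigma.fst (Sigma.snd q)) (Sigma.snd (Sigma.snd q))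
local notation "𝓔₂" => fun q : (r : (i : ι) × κ i) × μ (Sigma.fst r) (Sigma.snd r) => E'' (Sigma.fst (Sigma.fst q)) (Sigma.snd (Sigma.fst q)) (Sigma.snd q)

attribute [local instance] blocksMonoidal

/-- The additivity in the variable `q` after relabelling of the variables. -/
@[reducible]
def flattenMonoidal (Ψ : (∀ q : (i : ι) × (a : κ i) × μ i a, E'' q.1 q.2.1 q.2.2) ⥤ A)
    [∀ q x, (insAt (E := 𝓔₁) q x ⋙
      Ψ).Monoidal]
    (q : (q : (i : ι) × κ i) × μ q.1 q.2) (x : ∀ r : {r // r ≠ q}, E'' r.1.1.1 r.1.1.2 r.1.2) :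
    (insAt (E := 𝓔₂) q x ⋙
      flatten (A := E'') ⋙ Ψ).Monoidal :=
  Functor.Monoidal.transport (F := insAt (E := 𝓔₁) ⟨q.1.1, q.1.2, q.2⟩ _ ⋙ Ψ)
    (Functor.isoWhiskerRight (eqToIso (insAt_comp_flatten (A := E'') q x).symm) Ψ)

section

variable (Ψ : (∀ q : (i : ι) × (a : κ i) × μ i a, E'' q.1 q.2.1 q.2.2) ⥤ A)
    [∀ (q : (i : ι) × (a : κ i) × μ i a) (x : ∀ r : {r // r ≠ q}, E'' r.1.1 r.1.2.1 r.1.2.2),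
    (insAt (E := fun q : (i : ι) × (a : κ i) × μ i a => E'' q.1 q.2.1 q.2.2) q x ⋙ Ψ).Monoidal]

attribute [local instance] flattenMonoidal

theorem flatten_μ (q : (q : (i : ι) × κ i) × μ q.1 q.2)
    (x : ∀ r : {r // r ≠ q}, E'' r.1.1.1 r.1.1.2 r.1.2) (a a' : E'' q.1.1 q.1.2 q.2) :
    Functor.LaxMonoidal.μ (insAt (E := 𝓔₂) q x ⋙ flatten (A := E'') ⋙ Ψ) a a' =
      (Ψ.map (eqToHom (flatten_insAt q x a)) ⊗ₘ Ψ.map (eqToHom (flatten_insAt q x a'))) ≫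
        Functor.LaxMonoidal.μ (insAt (E := 𝓔₁) ⟨q.1.1, q.1.2, q.2⟩ (flattenOthers q x) ⋙ Ψ) a a' ≫
        Ψ.map (eqToHom (flatten_insAt q x (a ⊗ a')).symm) := by
  refine (Functor.Monoidal.transport_μ
    (F := insAt (E := 𝓔₁)
      ⟨q.1.1, q.1.2, q.2⟩ (flattenOthers q x) ⋙ Ψ)
    (Functor.isoWhiskerRight (eqToIso (insAt_comp_flatten (A := E'') q x).symm) Ψ) a a').trans ?_
  simp [eqToHom_app]

theorem flatten_ε (q : (q : (i : ι) × κ i) × μ q.1 q.2)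
    (x : ∀ r : {r // r ≠ q}, E'' r.1.1.1 r.1.1.2 r.1.2) :
    Functor.LaxMonoidal.ε (insAt (E := 𝓔₂) q x ⋙ flatten (A := E'') ⋙ Ψ) =
      Functor.LaxMonoidal.ε (insAt (E := 𝓔₁) ⟨q.1.1, q.1.2, q.2⟩ (flattenOthers q x) ⋙ Ψ) ≫
        Ψ.map (eqToHom (flatten_insAt q x _).symm) := by
  refine (Functor.Monoidal.transport_ε
    (F := insAt (E := 𝓔₁)
      ⟨q.1.1, q.1.2, q.2⟩ (flattenOthers q x) ⋙ Ψ)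
    (Functor.isoWhiskerRight (eqToIso (insAt_comp_flatten (A := E'') q x).symm) Ψ)).trans ?_
  simp [eqToHom_app]

end

variable (W : ∀ i a, (∀ c, E'' i a c) ⥤ E' i a) (R : ∀ i, (∀ a, E' i a) ⥤ E i) (Φ : (∀ i, E i) ⥤ A)
  [∀ i a c x, (insAt c x ⋙ W i a).Monoidal]
  [∀ i a x, (insAt a x ⋙ R i).Monoidal] [∀ i x, (insAt i x ⋙ Φ).Monoidal]

/-- Both bracketings expand to a structure morphism of `Φ` with one of `R` inside it and the
original one of `W` innermost. On one side the outer composite is expanded by `addHom_blocks`, on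
the other `map_blocks_μ_map` is used twice; the remaining discrepancies are identifications of
families, compared coordinatewise. -/
theorem blocksMonoidal_assoc (hΦ : IsNaturalInOthers Φ) (hR : ∀ i, IsNaturalInOthers (R i))
    (q : (q : (i : ι) × κ i) × μ q.1 q.2) (x : ∀ r : {r // r ≠ q}, E'' r.1.1.1 r.1.1.2 r.1.2) :
    blocksMonoidal (E := fun q : (i : ι) × κ i => E' q.1 q.2)
      (E' := fun (q : (i : ι) × κ i) c => E'' q.1 q.2 c) (fun q : (i : ι) × κ i => W q.1 q.2)
      (blocks R ⋙ Φ) q x =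
    letI : ∀ i c x, (insAt (E := fun q : (a : κ i) × μ i a => E'' i q.1 q.2) c x ⋙
        blocks (W i) ⋙ R i).Monoidal := fun i c x => blocksMonoidal (W i) (R i) c x
    letI : ∀ q x, (insAt (E := 𝓔₁) q x ⋙
      (blocks (E' := 𝓔₀)
        (fun i => blocks (W i) ⋙ R i) ⋙ Φ)).Monoidal := fun q x =>
        blocksMonoidal (E' := 𝓔₀) _ _ q x
    flattenMonoidal (blocks (E' := 𝓔₀)
      (fun i => blocks (W i) ⋙ R i) ⋙ Φ) q x := by
  let : ∀ i c x, (insAt (E := fun q : (a : κ i) × μ i a => E'' i q.1 q.2) c x ⋙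
      blocks (W i) ⋙ R i).Monoidal := fun i c x => blocksMonoidal (W i) (R i) c x
  let : ∀ q x, (insAt (E := 𝓔₁) q x ⋙
    (blocks (E' := 𝓔₀)
      (fun i => blocks (W i) ⋙ R i) ⋙ Φ)).Monoidal := fun q x =>
      blocksMonoidal (E' := 𝓔₀) _ _ q x
  let Ψ := blocks (E' := 𝓔₀)
      (fun i => blocks (W i) ⋙ R i)
  -- The inverse structure maps are determined by `ε` and `μ`, so only these are compared.
  apply Functor.Monoidal.toLaxMonoidal_injective
  apply Functor.LaxMonoidal.ext
  · refine (blocks_ε (R := fun q : (i : ι) × κ i => W q.1 q.2)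
      (blocks_isNaturalInOthers hΦ hR) q x).trans ?_
    refine (unitHom_blocks hΦ hR q.1 _).trans ?_
    refine Eq.trans ?_ (flatten_ε (Ψ ⋙ Φ) q x).symm
    refine Eq.trans ?_ (ε_blocks_map (E' := 𝓔₀)
      (R := fun i => blocks (W i) ⋙ R i) hΦ ⟨q.1.1, q.1.2, q.2⟩
      (eqToHom (flatten_insAt q x _).symm)).symm
    refine congrArg (unitHom Φ q.1.1) ?_
    refine Eq.trans ?_ (ε_blocks_map (E' := E'' q.1.1) (R := W q.1.1) (hR q.1.1)
      ⟨q.1.2, q.2⟩ (x := blockOthers (E' := 𝓔₀)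
        ⟨q.1.1, q.1.2, q.2⟩ (flattenOthers q x))
      (eqToHom (block_insAt (E' := 𝓔₀)
        ⟨q.1.1, q.1.2, q.2⟩ _ _).symm ≫
          (block (E' := 𝓔₀) q.1.1).map
            (eqToHom (flatten_insAt q x _).symm))).symm
    refine congrArg (unitHom (R q.1.1) q.1.2)
      (congrArg (_ ≫ ·) (congrArg (W _ _).map (funext fun c => ?_)))
    simp [eqToHom_map]
    rfl
  · funext a a'
    refine (blocks_μ (R := fun q : (i : ι) × κ i => W q.1 q.2)
      (blocks_isNaturalInOthers hΦ hR) q x a a').trans ?_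
    refine (addHom_blocks hΦ hR q.1 _ _ _).trans ?_
    unfold blocksAddHom
    refine Eq.trans ?_ (flatten_μ (Ψ ⋙ Φ) q x a a').symm
    refine Eq.trans ?_ (map_blocks_μ_map (E' := 𝓔₀)
      (R := fun i => blocks (W i) ⋙ R i) hΦ ⟨q.1.1, q.1.2, q.2⟩ (eqToHom (flatten_insAt q x a))
      (eqToHom (flatten_insAt q x a')) (eqToHom (flatten_insAt q x (a ⊗ a')).symm)).symm
    congr 1
    · funext j hj
      refine congrArg (R j).map (funext fun b => congrArg (W j b).map (funext fun c => ?_))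
      simp [eqToHom_map]
      rfl
    · funext j hj
      refine congrArg (R j).map (funext fun b => congrArg (W j b).map (funext fun c => ?_))
      simp [eqToHom_map]
      rfl
    · refine Eq.trans ?_ (map_blocks_μ_map (E' := E'' q.1.1) (R := W q.1.1) (hR q.1.1)
        ⟨q.1.2, q.2⟩ (x := blockOthers (E' := 𝓔₀)
          ⟨q.1.1, q.1.2, q.2⟩ (flattenOthers q x))
        ((block (E' := 𝓔₀) q.1.1).map (eqToHom (flatten_insAt q x a)) ≫ eqToHom (block_insAt
          (E' := 𝓔₀) ⟨q.1.1, q.1.2, q.2⟩ _ a))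
        ((block (E' := 𝓔₀) q.1.1).map (eqToHom (flatten_insAt q x a')) ≫ eqToHom (block_insAt
          (E' := 𝓔₀) ⟨q.1.1, q.1.2, q.2⟩ _ a'))
        (eqToHom (block_insAt (E' := 𝓔₀)
          ⟨q.1.1, q.1.2, q.2⟩ _ (a ⊗ a')).symm ≫
            (block (E' := 𝓔₀) q.1.1).map (eqToHom (flatten_insAt q x (a ⊗ a')).symm))).symm
      congr 1
      · funext b hb
        refine congrArg (W q.1.1 b).map (funext fun c => ?_)
        simp [eqToHom_map]
        rfl
      · funext b hb
        refine congrArg (W q.1.1 b).map (funext fun c => ?_)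
        simp [eqToHom_map]
        rfl
      · refine congrArg₂ (· ≫ ·) (congrArg₂ (· ⊗ₘ ·) (congrArg (W _ _).map (funext fun c => ?_))
          (congrArg (W _ _).map (funext fun c => ?_)))
          (congrArg (_ ≫ ·) (congrArg (W _ _).map (funext fun c => ?_)))
        · simp [eqToHom_map]
          rfl
        · simp [eqToHom_map]
          rfl
        · simp [eqToHom_map]
          rfl

end Associativity

/-! ### Associativity of the composition of multi-additive functors. -/

namespace MultiFunctor

section

variable {C : Type u} [Category.{v} C] {J : GrothendieckTopology C}
  {D : Type t} [Category.{t'} D] {ι : Type w} {κ : ι → Type w'} {p : D ⥤ C}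
  {H : ι → GrStack.{v', u'} J} {K : (i : ι) → κ i → GrStack.{v', u'} J}
  {G : GrStack.{v', u'} J} {F : MultiFunctor p H G} {P : ∀ i, MultiFunctor p (K i) (H i)}

/-- The two bracketings have definitionally equal functors on fibres, so `app` can be shared and
equality is tested on the remaining data without transport. -/
theorem mk_congr {app : ∀ d : D, (∀ i, Fib (H i).X (p.obj d)) ⥤ Fib G.X (p.obj d)}
    {ρ ρ' : ∀ {d e : D} (f : d ⟶ e), app e ⋙ res G.X (p.map f) ≅
      Functor.pi (fun i => res (H i).X (p.map f)) ⋙ app d}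
    {m m' : ∀ (d : D) (i : ι) (x : ∀ j : {j // j ≠ i}, Fib (H j).X (p.obj d)),
      (insAt (E := fun i => Fib (H i).X (p.obj d)) i x ⋙ app d).Monoidal}
    (hρ : ∀ {d e : D} (f : d ⟶ e) x, (ρ f).hom.app x = (ρ' f).hom.app x)
    (hm : ∀ d i x, m d i x = m' d i x) :
    (⟨app, ρ, m⟩ : MultiFunctor p H G) = ⟨app, ρ', m'⟩ := by
  obtain rfl : @ρ = @ρ' := by
    funext d e f
    ext x
    exact hρ f x
  obtain rfl : m = m' := by
    funext d i x
    exact hm d i x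
  rfl

theorem comp_assoc [Braiding G] [∀ i, Braiding (H i)] {r : ι → ι → Prop}
    {s : ∀ i, κ i → κ i → Prop} (hF : F.IsMultiAdditive r)
    (hP : ∀ i, (P i).IsMultiAdditive (s i)) {μ : (i : ι) → κ i → Type w''}
    {L : (i : ι) → (a : κ i) → μ i a → GrStack.{v', u'} J}
    (Q : ∀ i a, MultiFunctor p (L i a) (K i a)) :
    (F.comp P).comp (fun q : (i : ι) × κ i => Q q.1 q.2) =
      (F.comp fun i => (P i).comp (Q i)).relabel := by
  refine mk_congr (fun {d e} f x => ?_) (fun d q x => ?_)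
  · refine (comp_resIso_hom_app (F := F.comp P) (P := fun q : (i : ι) × κ i => Q q.1 q.2)
      f x).trans ?_
    refine (congrArg (· ≫ _) (comp_resIso_hom_app (F := F) (P := P) f _)).trans
      ((Category.assoc _ _ _).trans ?_)
    refine Eq.trans (congrArg (_ ≫ ·) ?_) (comp_resIso_hom_app (F := F)
      (P := fun i => (P i).comp (Q i)) f
      ((flatten (A := fun i a c => Fib (L i a c).X (p.obj e))).obj x)).symm
    refine ((F.app d).map_comp _ _).symm.trans (congrArg (F.app d).map (funext fun i => ?_))
    exact (comp_resIso_hom_app (F := P i) (P := Q i) f fun r => x ⟨⟨i, r.1⟩, r.2⟩).symm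
  · exact blocksMonoidal_assoc (E'' := fun i a c => Fib (L i a c).X (p.obj d))
      (fun i a => (Q i a).app d) (fun i => (P i).app d) (F.app d) (hF.isNaturalInOthers d)
      (fun i => (hP i).isNaturalInOthers d) q x

end

end MultiFunctor

end GrpLike

end

/-- Composition of multi-additive functors between group-like stacks. The functor `p : D ⥤ C` is
`𝟭 C` for the groupoids of global multi-additive functors and `Over.forget S` for the sections over
`S` of the stacks of multi-additive functors; the last clause, for `q = Over.map g : Over T ⥤ Over S`,
is the compatibility of the composition with restriction along `g : T ⟶ S`. -/
theorem proposition9 {C : Type u} [Category.{v} C] {J : GrothendieckTopology C}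
    {ι : Type w} [LinearOrder ι] [Finite ι]
    {κ : ι → Type w'} [∀ i, LinearOrder (κ i)] [∀ i, Finite (κ i)]
    (G : GrpLike.GrStack.{v', u'} J) [GrpLike.Braiding G]
    (H : ι → GrpLike.GrStack.{v', u'} J) [∀ i, GrpLike.Braiding (H i)]
    (K : (i : ι) → κ i → GrpLike.GrStack.{v', u'} J)
    {D : Type t} [Category.{t'} D] (p : D ⥤ C)
    (F : GrpLike.MultiFunctor p H G) (hF : F.IsMultiAdditive (· < ·)) (hFb : F.IsBraided)
    (P : ∀ i, GrpLike.MultiFunctor p (K i) (H i))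
    (hP : ∀ i, (P i).IsMultiAdditive (· < ·)) :
    (F.comp P).IsMultiAdditive (Sigma.Lex (· < ·) fun _ => (· < ·)) ∧
    (∀ [∀ i a, GrpLike.Braiding (K i a)], (∀ i, (P i).IsBraided) → (F.comp P).IsBraided) ∧
    (∀ {μ : (i : ι) → κ i → Type w''}
      (L : (i : ι) → (a : κ i) → μ i a → GrpLike.GrStack.{v', u'} J)
      (Q : ∀ i a, GrpLike.MultiFunctor p (L i a) (K i a)),
      (F.comp P).comp (fun q : (i : ι) × κ i => Q q.1 q.2) =
        (F.comp fun i => (P i).comp (Q i)).relabel) ∧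
    (∀ {D' : Type t} [Category.{t'} D'] (q : D' ⥤ D),
      (F.comp P).pull q = (F.pull q).comp fun i => (P i).pull q) := by
  -- Compatibility with restriction is definitional: the composition is formed fibre by fibre, and
  -- `pull` only reindexes the fibres.
  refine ⟨GrpLike.MultiFunctor.comp_isMultiAdditive (fun i => lt_irrefl i) hF hFb hP, fun hPb => ?_,
    fun L Q => GrpLike.MultiFunctor.comp_assoc hF hP Q, fun q => rfl⟩
  exact GrpLike.MultiFunctor.comp_isBraided hF hFb hP hPb
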